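/- Let $\mathrm{Homeo}^+(\mathbf{R})$ be the group of orientation-preserving homeomorphisms of the real line. Let $G$ be a finitely generated group of rank $k$ (i.e. $k$ is the smallest size of a generating set of $G$), and suppose that $G$ is isomorphic to a subgroup $\Gamma<\mathrm{Homeo}^+(\mathbf{R})$ with the following properties. (1) The action of $\Gamma$ on $\mathbf{R}$ is minimal, i.e. every orbit is dense. (2) The groups of germs of $\Gamma$ at $+\infty$ and at $-\infty$ are each topologically conjugate to a subgroup of the affine group: there are $\varphi_+,\varphi_-\in\mathrm{Homeo}^+(\mathbf{R})$ such that for every $g\in\Gamma$ the map $\varphi_+ g\varphi_+^{-1}$ agrees with an affine map $x\mapsto ax+b$ ($a\neq 0$) near $+\infty$, and $\varphi_- g\varphi_-^{-1}$ agrees with such an affine map near $-\infty$. (3) There are $f,g\in\Gamma$ and real numbers $r_1<r_2$ such that for all $x\in(-\infty,r_1)$ and $y\in(r_2,\infty)$ $$f(x)=x,\qquad f(y)\neq y,\qquad g(x)\neq x,\qquad g(y)=y.$$ (4) There is a compact interval $I=[a,b]$ with $a<b$ such that the subgroup of the elements of $\Gamma$ that fix each point of $\mathbf{R}\setminus I$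 is finitely generated. Let $\mathcal{G}_k$ be the space of marked groups: its points are the pairs $(K,S)$ of a group $K$ and an ordered generating set $S=(s_1,\dots,s_k)$ of $K$ of cardinality $k$ (a $k$-marking of $K$), up to isomorphisms of groups that match the ordered generating sets. The distance of two distinct points is $e^{-n}$, where $n$ is the largest number such that the balls of radius $n$ about the identity in the two Cayley graphs are isomorphic as rooted directed graphs with edges labelled by $1,\dots,k$ (and $n=0$ if there is no such number). Then there is a sequence $(S_n)_{n\in\mathbf{N}}$ of $k$-markings of $G$ such that $(G,S_n)$ converges in $\mathcal{G}_k$, as $n\to\infty$, to the free group $\mathbf{F}_k$ of rank $k$ with its standard marking. -/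

import Mathlib

open Filter Topology

universe u

/-! ### Homeomorphisms of the line -/

/-- The group `Homeo⁺(ℝ)` of orientation preserving homeomorphisms of the real line.  The product
is composition `(f * g) x = f (g x)`. -/
def HomeoPlus : Subgroup (ℝ ≃ₜ ℝ) where
  carrier := {f | StrictMono f}
  mul_mem' := fun {_ _} hf hg => hf.comp hg
  one_mem' := strictMono_id
  inv_mem' := fun {f} hf x y hxy => by
    have h : f (f.symm x) < f (f.symm y) := by simpa using hxy
    exact hf.lt_iff_lt.1 h

/-- The elements of `Γ` that fix each point of `ℝ ∖ I`. -/
def supportedSubgroup (Γ : Subgroup (ℝ ≃ₜ ℝ)) (I : Set ℝ) : Subgroup (ℝ ≃ₜ ℝ) where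
  carrier := {g | g ∈ Γ ∧ ∀ x, x ∉ I → g x = x}
  mul_mem' := fun {f g} hf hg =>
    ⟨Γ.mul_mem hf.1 hg.1, fun x hx => by
      change f (g x) = x
      rw [hg.2 x hx, hf.2 x hx]⟩
  one_mem' := ⟨Γ.one_mem, fun _ _ => rfl⟩
  inv_mem' := fun {f} hf => ⟨Γ.inv_mem hf.1, fun x hx => by
    change f.symm x = x
    rw [Homeomorph.symm_apply_eq, hf.2 x hx]⟩

/-- Condition (1): all orbits of `Γ` are dense. -/
def MinimalAction (Γ : Subgroup (ℝ ≃ₜ ℝ)) : Prop :=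
  ∀ x : ℝ, Dense {y : ℝ | ∃ g ∈ Γ, g x = y}

/-- The group of germs of `Γ` at the end `l` of the line (`l` is `atTop` for `+∞` and `atBot` for
`-∞`) is conjugate to a subgroup of the affine group: after conjugation by one orientation
preserving homeomorphism, the germ at `l` of each element of `Γ` is the germ of an affine map. -/
def AffineGermsAt (Γ : Subgroup (ℝ ≃ₜ ℝ)) (l : Filter ℝ) : Prop :=
  ∃ φ ∈ HomeoPlus, ∀ g ∈ Γ, ∃ A : ℝ ≃ᵃ[ℝ] ℝ, ⇑(φ * g * φ⁻¹) =ᶠ[l] ⇑A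

/-- Condition (3): existence of elements with one-sided supports. -/
def HasOneSidedElements (Γ : Subgroup (ℝ ≃ₜ ℝ)) : Prop :=
  ∃ f ∈ Γ, ∃ g ∈ Γ, ∃ r₁ r₂ : ℝ, r₁ < r₂ ∧
    ∀ x ∈ Set.Iio r₁, ∀ y ∈ Set.Ioi r₂, f x = x ∧ f y ≠ y ∧ g x ≠ x ∧ g y = y

/-- Condition (4): for some compact interval (with nonempty interior), the subgroup of elements
that fix each point outside it is finitely generated. -/
def HasFGIntervalSubgroup (Γ : Subgroup (ℝ ≃ₜ ℝ)) : Prop :=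
  ∃ a b : ℝ, a < b ∧ (supportedSubgroup Γ (Set.Icc a b)).FG

/-- The class `𝒞`: the groups isomorphic to a subgroup of `Homeo⁺(ℝ)` satisfying (1)-(4). -/
def InClassC (G : Type u) [Group G] : Prop :=
  ∃ Γ : Subgroup (ℝ ≃ₜ ℝ), Nonempty (G ≃* Γ) ∧ Γ ≤ HomeoPlus ∧
    MinimalAction Γ ∧ (AffineGermsAt Γ atTop ∧ AffineGermsAt Γ atBot) ∧
    HasOneSidedElements Γ ∧ HasFGIntervalSubgroup Γ

/-! ### The space of marked groups -/

/-- A `k`-marking of `G`: an ordered generating set of `G` of cardinality `k`. -/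
structure GroupMarking (k : ℕ) (G : Type u) [Group G] where
  gen : Fin k → G
  gen_injective : Function.Injective gen
  closure_range_gen : Subgroup.closure (Set.range gen) = ⊤

/-- A group together with a `k`-marking. -/
structure MarkedGroup (k : ℕ) : Type (u + 1) where
  carrier : Type u
  [group : Group carrier]
  marking : GroupMarking k carrier

attribute [instance] MarkedGroup.group

namespace MarkedGroup

variable {k : ℕ}

/-- The `i`-th element of the marking. -/
def gen (M : MarkedGroup.{u} k) (i : Fin k) : M.carrier := M.marking.gen i

/-- The element represented by a word; the letter `(i, true)` stands for the `i`-th generator and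
`(i, false)` for its inverse. -/
def eval (M : MarkedGroup.{u} k) (w : List (Fin k × Bool)) : M.carrier :=
  (w.map fun p => if p.2 then M.gen p.1 else (M.gen p.1)⁻¹).prod

/-- The vertices of the `n`-ball about the identity in the Cayley graph. -/
def ball (M : MarkedGroup.{u} k) (n : ℕ) : Set M.carrier :=
  {g | ∃ w : List (Fin k × Bool), w.length ≤ n ∧ M.eval w = g}

/-- The `n`-balls in the marked Cayley graphs are isomorphic: there is a bijection that preserves
the centre and, in both directions, the edges `g ⟶ g * sᵢ` with their labels `i`. -/
def BallIso (n : ℕ) (M N : MarkedGroup.{u} k) : Prop :=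
  ∃ φ : M.ball n ≃ N.ball n,
    (∀ x : M.ball n, (x : M.carrier) = 1 ↔ (φ x : N.carrier) = 1) ∧
    ∀ (x y : M.ball n) (i : Fin k),
      (y : M.carrier) = x * M.gen i ↔ (φ y : N.carrier) = φ x * N.gen i

/-- Two marked groups are equivalent if some isomorphism matches the markings in order. -/
def Equivalent (M N : MarkedGroup.{u} k) : Prop :=
  ∃ e : M.carrier ≃* N.carrier, ∀ i, e (M.gen i) = N.gen i

open Classical in
/-- The distance: `e⁻ⁿ` where `n` is the largest number such that the `n`-balls are isomorphic,
and `0` if all balls are isomorphic.  (If even the `0`-balls differ, which happens when exactly one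
of the two identity vertices has a loop with some label, the distance is `1 = e⁰`.) -/
noncomputable def markedDist (M N : MarkedGroup.{u} k) : ℝ :=
  if ∀ n, BallIso n M N then 0 else Real.exp (-((sSup {n : ℕ | BallIso n M N} : ℕ) : ℝ))

theorem Equivalent.refl (M : MarkedGroup.{u} k) : Equivalent M M :=
  ⟨MulEquiv.refl _, fun _ => rfl⟩

theorem Equivalent.symm {M N : MarkedGroup.{u} k} (h : Equivalent M N) : Equivalent N M := by
  obtain ⟨e, he⟩ := h
  exact ⟨e.symm, fun i => by rw [← he i, e.symm_apply_apply]⟩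

theorem Equivalent.trans {M N P : MarkedGroup.{u} k} (h : Equivalent M N) (h' : Equivalent N P) :
    Equivalent M P := by
  obtain ⟨e, he⟩ := h
  obtain ⟨e', he'⟩ := h'
  exact ⟨e.trans e', fun i => by simp [he, he']⟩

theorem BallIso.symm {n : ℕ} {M N : MarkedGroup.{u} k} (h : BallIso n M N) : BallIso n N M := by
  obtain ⟨φ, h1, h2⟩ := h
  refine ⟨φ.symm, fun x => ?_, fun x y i => ?_⟩
  · rw [h1 (φ.symm x), φ.apply_symm_apply]
  · rw [h2 (φ.symm x) (φ.symm y) i, φ.apply_symm_apply, φ.apply_symm_apply]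

theorem BallIso.trans {n : ℕ} {M N P : MarkedGroup.{u} k} (h : BallIso n M N)
    (h' : BallIso n N P) : BallIso n M P := by
  obtain ⟨φ, h1, h2⟩ := h
  obtain ⟨ψ, h3, h4⟩ := h'
  exact ⟨φ.trans ψ, fun x => (h1 x).trans (h3 _), fun x y i => (h2 x y i).trans (h4 _ _ i)⟩

theorem eval_append_singleton (M : MarkedGroup.{u} k) (w : List (Fin k × Bool))
    (p : Fin k × Bool) :
    M.eval (w ++ [p]) = M.eval w * (if p.2 then M.gen p.1 else (M.gen p.1)⁻¹) := by
  simp [eval]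

theorem map_eval {M N : MarkedGroup.{u} k} (e : M.carrier ≃* N.carrier)
    (he : ∀ i, e (M.gen i) = N.gen i) (w : List (Fin k × Bool)) :
    e (M.eval w) = N.eval w := by
  induction w using List.reverseRecOn with
  | nil => simp [eval]
  | append_singleton w p ih =>
    rw [eval_append_singleton, eval_append_singleton, map_mul, ih]
    split_ifs <;> simp [he]

theorem Equivalent.ballIso {M N : MarkedGroup.{u} k} (h : Equivalent M N) (n : ℕ) :
    BallIso n M N := by
  obtain ⟨e, he⟩ := h
  have hb : ∀ x, x ∈ M.ball n ↔ e x ∈ N.ball n := by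
    intro x
    constructor
    · rintro ⟨w, hw, rfl⟩
      exact ⟨w, hw, (map_eval e he w).symm⟩
    · rintro ⟨w, hw, hx⟩
      exact ⟨w, hw, e.injective (by rw [map_eval e he w, hx])⟩
  refine ⟨e.toEquiv.subtypeEquiv hb, fun x => ?_, fun x y i => ?_⟩
  · simp
  · change (y : M.carrier) = x * M.gen i ↔ e y = e x * N.gen i
    rw [← he i, ← map_mul, e.injective.eq_iff]

theorem ballIso_eval {n : ℕ} {M N : MarkedGroup.{u} k} (φ : M.ball n ≃ N.ball n)
    (h1 : ∀ x : M.ball n, (x : M.carrier) = 1 ↔ (φ x : N.carrier) = 1)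
    (h2 : ∀ (x y : M.ball n) (i : Fin k),
      (y : M.carrier) = x * M.gen i ↔ (φ y : N.carrier) = φ x * N.gen i)
    (w : List (Fin k × Bool)) :
    ∀ hw : w.length ≤ n, (φ ⟨M.eval w, w, hw, rfl⟩ : N.carrier) = N.eval w := by
  induction w using List.reverseRecOn with
  | nil =>
    intro hw
    exact (h1 _).1 (by simp [eval])
  | append_singleton w p ih =>
    intro hw
    have hw' : w.length ≤ n := by simp at hw; omega
    have ih := ih hw'
    obtain ⟨i, b⟩ := p
    cases b with
    | true =>
      have := (h2 ⟨M.eval w, w, hw', rfl⟩ ⟨M.eval (w ++ [(i, true)]), _, hw, rfl⟩ i).1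
        (by simp [eval_append_singleton])
      rw [this, ih, eval_append_singleton]
      simp
    | false =>
      have := (h2 ⟨M.eval (w ++ [(i, false)]), _, hw, rfl⟩ ⟨M.eval w, w, hw', rfl⟩ i).1
        (by simp [eval_append_singleton])
      rw [ih] at this
      rw [eval_append_singleton N, this]
      simp

theorem ball_mono (M : MarkedGroup.{u} k) {m n : ℕ} (h : m ≤ n) : M.ball m ⊆ M.ball n := by
  rintro _ ⟨w, hw, rfl⟩
  exact ⟨w, hw.trans h, rfl⟩

theorem BallIso.mono {m n : ℕ} (hmn : m ≤ n) {M N : MarkedGroup.{u} k} (h : BallIso n M N) :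
    BallIso m M N := by
  obtain ⟨φ, h1, h2⟩ := h
  have key := ballIso_eval φ h1 h2
  have hmem : ∀ x (hx : x ∈ M.ball m), (φ ⟨x, M.ball_mono hmn hx⟩ : N.carrier) ∈ N.ball m := by
    rintro x ⟨w, hw, rfl⟩
    exact ⟨w, hw, (key w (hw.trans hmn)).symm⟩
  let f : M.ball m → N.ball m := fun x => ⟨φ ⟨x, M.ball_mono hmn x.2⟩, hmem x x.2⟩
  have hf : Function.Bijective f := by
    constructor
    · intro x y hxy
      have h3 : (φ ⟨x, M.ball_mono hmn x.2⟩ : N.carrier) = φ ⟨y, M.ball_mono hmn y.2⟩ :=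
        Subtype.mk.inj hxy
      have h4 := φ.injective (Subtype.ext h3)
      exact Subtype.ext (Subtype.mk.inj h4)
    · rintro ⟨_, w, hw, rfl⟩
      exact ⟨⟨M.eval w, w, hw, rfl⟩, Subtype.ext (key w (hw.trans hmn))⟩
  exact ⟨Equiv.ofBijective f hf, fun x => h1 ⟨x, M.ball_mono hmn x.2⟩,
    fun x y i => h2 ⟨x, M.ball_mono hmn x.2⟩ ⟨y, M.ball_mono hmn y.2⟩ i⟩

theorem BallIso.eval_eq_one {n : ℕ} {M N : MarkedGroup.{u} k} (h : BallIso n M N)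
    (w : List (Fin k × Bool)) (hw : w.length ≤ n) : M.eval w = 1 ↔ N.eval w = 1 := by
  obtain ⟨φ, h1, h2⟩ := h
  rw [← ballIso_eval φ h1 h2 w hw]
  exact h1 ⟨M.eval w, w, hw, rfl⟩

theorem lift_mk (M : MarkedGroup.{u} k) (w : List (Fin k × Bool)) :
    FreeGroup.lift M.gen (FreeGroup.mk w) = M.eval w := by
  rw [FreeGroup.lift_mk, eval]
  congr 1
  refine List.map_congr_left fun p _ => ?_
  cases p.2 <;> simp

theorem lift_surjective (M : MarkedGroup.{u} k) :
    Function.Surjective (FreeGroup.lift M.gen) := by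
  rw [← MonoidHom.range_eq_top, FreeGroup.range_lift_eq_closure]
  exact M.marking.closure_range_gen

theorem equivalent_of_ballIso {M N : MarkedGroup.{u} k} (h : ∀ n, BallIso n M N) :
    Equivalent M N := by
  have hker : (FreeGroup.lift M.gen).ker = (FreeGroup.lift N.gen).ker := by
    ext x
    obtain ⟨w, rfl⟩ : ∃ w, FreeGroup.mk w = x := ⟨x.toWord, FreeGroup.mk_toWord⟩
    rw [MonoidHom.mem_ker, MonoidHom.mem_ker, lift_mk, lift_mk]
    exact (h w.length).eval_eq_one w le_rfl
  let eM := QuotientGroup.quotientKerEquivOfSurjective _ M.lift_surjective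
  let eN := QuotientGroup.quotientKerEquivOfSurjective _ N.lift_surjective
  refine ⟨eM.symm.trans ((QuotientGroup.quotientMulEquivOfEq hker).trans eN), fun i => ?_⟩
  have hM : eM.symm (M.gen i) = QuotientGroup.mk (FreeGroup.of i) := by
    rw [MulEquiv.symm_apply_eq]
    exact (FreeGroup.lift_apply_of (f := M.gen) (x := i)).symm
  simp only [MulEquiv.trans_apply, hM]
  exact FreeGroup.lift_apply_of (f := N.gen) (x := i)

theorem bddAbove_ballIso {n : ℕ} {M N : MarkedGroup.{u} k} (h : ¬ BallIso n M N) :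
    n - 1 ∈ upperBounds {m : ℕ | BallIso m M N} := by
  intro m hm
  by_contra hlt
  exact h (BallIso.mono (by omega) hm)

theorem exp_le_markedDist {n : ℕ} {M N : MarkedGroup.{u} k} (h : ¬ BallIso n M N) :
    Real.exp (-((n - 1 : ℕ) : ℝ)) ≤ markedDist M N := by
  rw [markedDist, if_neg fun h' => h (h' n)]
  refine Real.exp_le_exp.2 (neg_le_neg (Nat.cast_le.2 ?_))
  rcases Set.eq_empty_or_nonempty {m : ℕ | BallIso m M N} with he | hne
  · rw [he]
    simp
  · exact csSup_le hne (bddAbove_ballIso h)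

theorem markedDist_le_exp {n : ℕ} {M N : MarkedGroup.{u} k} (h : ∀ m < n, BallIso m M N) :
    markedDist M N ≤ Real.exp (-((n - 1 : ℕ) : ℝ)) := by
  rw [markedDist]
  split_ifs with hall
  · exact (Real.exp_pos _).le
  · refine Real.exp_le_exp.2 (neg_le_neg (Nat.cast_le.2 ?_))
    obtain ⟨m, hm⟩ := not_forall.1 hall
    rcases Nat.eq_zero_or_pos n with rfl | hn
    · simp
    · exact le_csSup ⟨_, bddAbove_ballIso hm⟩ (h (n - 1) (by omega))

theorem markedDist_nonneg (M N : MarkedGroup.{u} k) : 0 ≤ markedDist M N := by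
  rw [markedDist]
  split_ifs
  · exact le_rfl
  · exact (Real.exp_pos _).le

theorem markedDist_comm (M N : MarkedGroup.{u} k) : markedDist M N = markedDist N M := by
  have h : ∀ n, BallIso n M N ↔ BallIso n N M := fun n => ⟨BallIso.symm, BallIso.symm⟩
  classical
  have h' : {n | BallIso n M N} = {n | BallIso n N M} := Set.ext h
  rw [markedDist, markedDist, h']
  exact if_congr (forall_congr' h) rfl rfl

theorem markedDist_eq_zero_iff (M N : MarkedGroup.{u} k) :
    markedDist M N = 0 ↔ Equivalent M N := by
  constructor
  · intro h
    rw [markedDist] at h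
    split_ifs at h with hall
    · exact equivalent_of_ballIso hall
    · exact absurd h (Real.exp_pos _).ne'
  · intro h
    rw [markedDist, if_pos h.ballIso]

theorem markedDist_triangle (M N P : MarkedGroup.{u} k) :
    markedDist M P ≤ markedDist M N + markedDist N P := by
  classical
  by_cases hall : ∀ n, BallIso n M P
  · rw [markedDist, if_pos hall]
    exact add_nonneg (markedDist_nonneg _ _) (markedDist_nonneg _ _)
  · have hex : ∃ n, ¬ BallIso n M P := not_forall.1 hall
    have hle : markedDist M P ≤ Real.exp (-((Nat.find hex - 1 : ℕ) : ℝ)) :=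
      markedDist_le_exp fun m hm => not_not.1 (Nat.find_min hex hm)
    have h0 := markedDist_nonneg M N
    have h0' := markedDist_nonneg N P
    by_cases h1 : BallIso (Nat.find hex) M N
    · have h2 : ¬ BallIso (Nat.find hex) N P := fun h2 => Nat.find_spec hex (h1.trans h2)
      have := exp_le_markedDist h2
      linarith
    · have := exp_le_markedDist h1
      linarith

/-- Equivalence of marked groups as a setoid. -/
instance setoid (k : ℕ) : Setoid (MarkedGroup.{u} k) where
  r := Equivalent
  iseqv := ⟨Equivalent.refl, Equivalent.symm, Equivalent.trans⟩

end MarkedGroup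

/-- The space `𝒢ₖ` of marked groups: groups with a `k`-marking, up to equivalence. -/
def MarkedGroupSpace (k : ℕ) : Type (u + 1) := Quotient (MarkedGroup.setoid.{u} k)

theorem MarkedGroup.markedDist_congr {k : ℕ} (M N M' N' : MarkedGroup.{u} k)
    (h : MarkedGroup.Equivalent M M') (h' : MarkedGroup.Equivalent N N') :
    markedDist M N = markedDist M' N' := by
  have e : ∀ n, BallIso n M N ↔ BallIso n M' N' := fun n =>
    ⟨fun x => (h.symm.ballIso n).trans (x.trans (h'.ballIso n)),
      fun x => (h.ballIso n).trans (x.trans (h'.symm.ballIso n))⟩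
  classical
  have e' : {n | BallIso n M N} = {n | BallIso n M' N'} := Set.ext e
  rw [markedDist, markedDist, e']
  exact if_congr (forall_congr' e) rfl rfl

noncomputable instance MarkedGroupSpace.metricSpace (k : ℕ) :
    MetricSpace (MarkedGroupSpace.{u} k) where
  dist := Quotient.lift₂ MarkedGroup.markedDist fun M N M' N' h h' =>
    MarkedGroup.markedDist_congr M N M' N' h h'
  dist_self := by
    rintro ⟨M⟩
    exact (MarkedGroup.markedDist_eq_zero_iff M M).2 (MarkedGroup.Equivalent.refl M)
  dist_comm := by
    rintro ⟨M⟩ ⟨N⟩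
    exact MarkedGroup.markedDist_comm M N
  dist_triangle := by
    rintro ⟨M⟩ ⟨N⟩ ⟨P⟩
    exact MarkedGroup.markedDist_triangle M N P
  eq_of_dist_eq_zero := by
    rintro ⟨M⟩ ⟨N⟩ h
    exact Quotient.sound ((MarkedGroup.markedDist_eq_zero_iff M N).1 h)

/-- The point `(G, S)` of `𝒢ₖ`. -/
def GroupMarking.toSpace {k : ℕ} {G : Type u} [Group G] (S : GroupMarking k G) :
    MarkedGroupSpace.{u} k :=
  Quotient.mk (MarkedGroup.setoid.{u} k) ⟨G, S⟩

/-- The standard marking of the free group `𝐅ₖ` by its basis.  (The basis is lifted so that the free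
group lives in the universe of the groups considered.) -/
def standardFreeMarking (k : ℕ) : GroupMarking k (FreeGroup (ULift.{u} (Fin k))) where
  gen := fun i => FreeGroup.of (ULift.up i)
  gen_injective := fun _ _ h => ULift.up_injective (FreeGroup.of_injective h)
  closure_range_gen := by
    rw [← FreeGroup.closure_range_of]
    congr 1
    ext x
    constructor
    · rintro ⟨i, rfl⟩
      exact ⟨ULift.up i, rfl⟩
    · rintro ⟨⟨i⟩, rfl⟩
      exact ⟨i, rfl⟩

/-! Let `D` be the commutator subgroup of the compactly supported elements of `Γ`. One-sided
elements and minimality provide, at every point, elements of `D` with arbitrarily small support that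
move it (`exists_compactDerived_ne`). A generating tuple `γ` is perturbed by right multiplication
with elements of `D` supported in a half-line `(-∞, B)`, so that it still generates `Γ` but
satisfies no relation of length at most `n`. These tuples give the markings.

Freeness (`exists_forall_lift_ne_one`): follow a point along a reduced word. Before each letter is
applied, alter its generator near the current point so that the next point is new; reducedness
ensures that earlier steps are not disturbed. Successive words are treated further and further to
the left, out of reach of the trajectories already built.

Generation (`exists_perturbation_generates`): let `H` be generated by the perturbed tuple. Words for
the finitely many generators of an interval group on `[a, b]` keep their values on some `[ρ, ∞)`
with `ρ < a`, and near `-∞`, so each element of that group lies in `H` up to an error in a compact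
part of `(-∞, ρ)`. Conjugating one of two such approximations by an element of `H` moves its error
to the left of the other error, and their commutator becomes exact. Further words expand `[a, b]`
over any compact set, so conjugation gives `D ≤ H`, and hence `H = Γ`. Besides agreement on `[B,
∞)`, this needs two words to push half-lines to the left, a condition stable under small
perturbations (`IsPerturbation.eventually_update`); so both constructions can be carried out
together. -/

/-! ### Dynamics of homeomorphisms of the line -/

namespace Homeomorph

theorem pow_apply_mem_Icc {u : ℝ ≃ₜ ℝ} {d x : ℝ} (h : ∀ y ∈ Set.Icc d x, u y < y)
    (hd : ∀ n : ℕ, d ≤ (u ^ n) x) (n : ℕ) : (u ^ n) x ∈ Set.Icc d x := by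
  induction n with
  | zero => exact ⟨by simpa using hd 0, le_rfl⟩
  | succ n ih =>
    refine ⟨hd _, ?_⟩
    rw [pow_succ', mul_apply]
    exact (h _ ih).le.trans ih.2

/-- Otherwise the decreasing orbit would converge to a fixed point of `u` in `[d, x]`. -/
theorem exists_pow_apply_lt {u : ℝ ≃ₜ ℝ} {d x : ℝ} (h : ∀ y ∈ Set.Icc d x, u y < y) :
    ∃ n : ℕ, (u ^ n) x < d := by
  by_contra! hd
  have hmem := pow_apply_mem_Icc h hd
  have hanti : Antitone fun n : ℕ => (u ^ n) x := antitone_nat_of_succ_le fun n => by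
    rw [pow_succ', mul_apply]
    exact (h _ (hmem n)).le
  have hbdd : BddBelow (Set.range fun n : ℕ => (u ^ n) x) :=
    ⟨d, by rintro _ ⟨n, rfl⟩; exact hd n⟩
  obtain ⟨L, hL⟩ : ∃ L, Tendsto (fun n : ℕ => (u ^ n) x) atTop (𝓝 L) :=
    ⟨_, tendsto_atTop_ciInf hanti hbdd⟩
  have hLmem : L ∈ Set.Icc d x := isClosed_Icc.mem_of_tendsto hL (Eventually.of_forall hmem)
  have h1 : Tendsto (fun n : ℕ => (u ^ (n + 1)) x) atTop (𝓝 (u L)) := by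
    simp only [pow_succ', mul_apply]
    exact (u.continuous.tendsto L).comp hL
  have h2 := tendsto_nhds_unique h1 ((tendsto_add_atTop_iff_nat 1).2 hL)
  exact (h L hLmem).ne h2

theorem lt_or_gt_of_forall_ne {s : Set ℝ} (hs : IsPreconnected s) (f : ℝ ≃ₜ ℝ)
    (h : ∀ x ∈ s, f x ≠ x) : (∀ x ∈ s, f x < x) ∨ ∀ x ∈ s, x < f x := by
  by_contra! hc
  obtain ⟨⟨x, hx, hx'⟩, y, hy, hy'⟩ := hc
  obtain ⟨z, hz, hz'⟩ := hs.intermediate_value₂ hy hx f.continuous.continuousOn continuousOn_id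
    hy' hx'
  exact h z hz hz'

theorem symm_lt_self_of_lt {f : ℝ ≃ₜ ℝ} (hf : StrictMono f) {x : ℝ} (h : x < f x) :
    f.symm x < x := by
  rw [← hf.lt_iff_lt]
  simpa using h

theorem lt_symm_self_of_lt {f : ℝ ≃ₜ ℝ} (hf : StrictMono f) {x : ℝ} (h : f x < x) :
    x < f.symm x := by
  rw [← hf.lt_iff_lt]
  simpa using h

theorem pow_apply_eq_self {f : ℝ ≃ₜ ℝ} {x : ℝ} (h : f x = x) (n : ℕ) : (f ^ n) x = x := by
  induction n with
  | zero => rfl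
  | succ n ih => rw [pow_succ, mul_apply, h, ih]

theorem symm_apply_eq_self {f : ℝ ≃ₜ ℝ} {x : ℝ} (h : f x = x) : f.symm x = x := by
  rw [symm_apply_eq, h]

/-- The set of points moved by a bijection is invariant under it, so disjoint supports suffice. -/
theorem commute_of_forall {f g : ℝ ≃ₜ ℝ} (h : ∀ x, f x = x ∨ g x = x) : Commute f g := by
  ext x
  rw [mul_apply, mul_apply]
  rcases h x with hx | hx
  · rw [hx]
    rcases h (g x) with h' | h'
    · exact h'
    · rw [g.injective h', hx]
  · rw [hx]
    rcases h (f x) with h' | h'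
    · rw [f.injective h', hx]
    · exact h'.symm

end Homeomorph

open Homeomorph

/-! ### One-sided elements and contraction of intervals -/

/-- Take `p` to be the largest fixed point. Beyond it the displacement has constant sign, made
negative by passing to the inverse if necessary. -/
theorem exists_right_sided {Γ : Subgroup (ℝ ≃ₜ ℝ)} (hΓ : Γ ≤ HomeoPlus)
    (hos : HasOneSidedElements Γ) :
    ∃ f ∈ Γ, ∃ r p : ℝ, r ≤ p ∧ (∀ x < r, f x = x) ∧ f p = p ∧ ∀ x, p < x → f x < x := by
  obtain ⟨f, hf, _, _, r₁, r₂, hr, h⟩ := hos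
  have h1 : ∀ x < r₁, f x = x := fun x hx => (h x hx (r₂ + 1) (by simp)).1
  have h2 : ∀ y, r₂ < y → f y ≠ y := fun y hy => (h (r₁ - 1) (by simp) y hy).2.1
  have hbdd : BddAbove {x | f x = x} := ⟨r₂, fun x hx => not_lt.1 fun hlt => h2 x hlt hx⟩
  have hne : {x | f x = x}.Nonempty := ⟨r₁ - 1, h1 _ (by simp)⟩
  have hcl : IsClosed {x | f x = x} := isClosed_eq f.continuous continuous_id
  set p := sSup {x | f x = x} with hp
  have hfp : f p = p := hcl.csSup_mem hne hbdd
  have hgt : ∀ x ∈ Set.Ioi p, f x ≠ x := fun x hx he => not_le.2 hx (le_csSup hbdd he)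
  have hrp : r₁ ≤ p := le_of_forall_lt fun c hc => by
    obtain ⟨d, hcd, hd⟩ := exists_between hc
    exact hcd.trans_le (le_csSup hbdd (h1 d hd))
  rcases lt_or_gt_of_forall_ne isPreconnected_Ioi f hgt with hs | hs
  · exact ⟨f, hf, r₁, p, hrp, h1, hfp, hs⟩
  · exact ⟨f⁻¹, Γ.inv_mem hf, r₁, p, hrp, fun x hx => symm_apply_eq_self (h1 x hx),
      symm_apply_eq_self hfp, fun x hx => symm_lt_self_of_lt (hΓ hf) (hs x hx)⟩

theorem exists_left_sided {Γ : Subgroup (ℝ ≃ₜ ℝ)} (hΓ : Γ ≤ HomeoPlus)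
    (hos : HasOneSidedElements Γ) :
    ∃ g ∈ Γ, ∃ q r : ℝ, q ≤ r ∧ (∀ x, r < x → g x = x) ∧ ∀ x < q, g x < x := by
  obtain ⟨_, _, g, hg, r₁, r₂, hr, h⟩ := hos
  have h1 : ∀ x, r₂ < x → g x = x := fun x hx => (h (r₁ - 1) (by simp) x hx).2.2.2
  have h2 : ∀ y ∈ Set.Iio r₁, g y ≠ y := fun y hy => (h y hy (r₂ + 1) (by simp)).2.2.1
  rcases lt_or_gt_of_forall_ne isPreconnected_Iio g h2 with hs | hs
  · exact ⟨g, hg, r₁, r₂, hr.le, h1, hs⟩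
  · exact ⟨g⁻¹, Γ.inv_mem hg, r₁, r₂, hr.le, fun x hx => symm_apply_eq_self (h1 x hx),
      fun x hx => symm_lt_self_of_lt (hΓ hg) (hs x hx)⟩

theorem MinimalAction.exists_mem_Ioo {Γ : Subgroup (ℝ ≃ₜ ℝ)} (hmin : MinimalAction Γ) (x : ℝ)
    {u v : ℝ} (huv : u < v) : ∃ s ∈ Γ, s x ∈ Set.Ioo u v := by
  obtain ⟨_, ⟨s, hs, rfl⟩, hy⟩ := (hmin x).exists_between huv
  exact ⟨s, hs, hy⟩

/-- The right-sided element attracts everything beyond `p` towards `p`: `s₁` brings `a` to the right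
of `p`, a power of `f` squeezes the interval against `p`, and `s₂` carries `p` into the target. -/
theorem exists_contraction {Γ : Subgroup (ℝ ≃ₜ ℝ)} (hΓ : Γ ≤ HomeoPlus)
    (hmin : MinimalAction Γ) (hos : HasOneSidedElements Γ) (a b : ℝ) {u v : ℝ} (huv : u < v) :
    ∃ s ∈ Γ, u < s a ∧ s b < v := by
  obtain ⟨f, hf, -, p, -, -, hfp, hlt⟩ := exists_right_sided hΓ hos
  obtain ⟨s₁, hs₁, hs₁a⟩ := hmin.exists_mem_Ioo a (lt_add_one p)
  obtain ⟨s₂, hs₂, hs₂p⟩ := hmin.exists_mem_Ioo p huv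
  have hev : ∀ᶠ y in 𝓝 p, s₂ y < v :=
    s₂.continuous.continuousAt.eventually_lt continuousAt_const hs₂p.2
  obtain ⟨d, hd, hpd⟩ := ((hev.filter_mono nhdsWithin_le_nhds).and self_mem_nhdsWithin :
    ∀ᶠ y in 𝓝[>] p, s₂ y < v ∧ y ∈ Set.Ioi p).exists
  obtain ⟨n, hn⟩ := exists_pow_apply_lt (u := f) (d := d) (x := s₁ b)
    fun y hy => hlt y (lt_of_lt_of_le hpd hy.1)
  have hfn := Γ.pow_mem hf n
  refine ⟨s₂ * f ^ n * s₁, Γ.mul_mem (Γ.mul_mem hs₂ hfn) hs₁, ?_, ?_⟩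
  · refine hs₂p.1.trans (hΓ hs₂ ?_)
    rw [← pow_apply_eq_self hfp n]
    exact hΓ hfn hs₁a.1
  · exact (hΓ hs₂ hn).trans hd

/-! ### Compactly supported elements -/

/-- The elements of `Γ` with compact support. -/
def compactSupportSubgroup (Γ : Subgroup (ℝ ≃ₜ ℝ)) : Subgroup (ℝ ≃ₜ ℝ) where
  carrier := {g | ∃ a b, g ∈ supportedSubgroup Γ (Set.Icc a b)}
  one_mem' := ⟨0, 0, Subgroup.one_mem _⟩
  inv_mem' := fun ⟨a, b, h⟩ => ⟨a, b, Subgroup.inv_mem _ h⟩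
  mul_mem' := by
    rintro f g ⟨a, b, hf, hf'⟩ ⟨c, d, hg, hg'⟩
    refine ⟨min a c, max b d, Γ.mul_mem hf hg, fun x hx => ?_⟩
    have h1 : x ∉ Set.Icc a b := fun h =>
      hx ⟨(min_le_left _ _).trans h.1, h.2.trans (le_max_left _ _)⟩
    have h2 : x ∉ Set.Icc c d := fun h =>
      hx ⟨(min_le_right _ _).trans h.1, h.2.trans (le_max_right _ _)⟩
    rw [mul_apply, hg' x h2, hf' x h1]

theorem supportedSubgroup_mono (Γ : Subgroup (ℝ ≃ₜ ℝ)) {I J : Set ℝ} (h : I ⊆ J) :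
    supportedSubgroup Γ I ≤ supportedSubgroup Γ J :=
  fun _ hg => ⟨hg.1, fun x hx => hg.2 x fun hI => hx (h hI)⟩

theorem conj_mem_supportedSubgroup {Γ : Subgroup (ℝ ≃ₜ ℝ)} {s g : ℝ ≃ₜ ℝ} (hs : s ∈ Γ)
    {I : Set ℝ} (hg : g ∈ supportedSubgroup Γ I) :
    s * g * s⁻¹ ∈ supportedSubgroup Γ (s.symm ⁻¹' I) := by
  refine ⟨Γ.mul_mem (Γ.mul_mem hs hg.1) (Γ.inv_mem hs), fun x hx => ?_⟩
  rw [mul_apply, mul_apply, inv_apply, hg.2 _ hx, apply_symm_apply]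

theorem preimage_symm_Icc {s : ℝ ≃ₜ ℝ} (hs : StrictMono s) (a b : ℝ) :
    s.symm ⁻¹' Set.Icc a b = Set.Icc (s a) (s b) := by
  ext x
  rw [Set.mem_preimage, Set.mem_Icc, Set.mem_Icc, ← hs.le_iff_le, ← hs.le_iff_le (a := s.symm x),
    apply_symm_apply]

/-- The commutator subgroup of the group of compactly supported elements. -/
def compactDerived (Γ : Subgroup (ℝ ≃ₜ ℝ)) : Subgroup (ℝ ≃ₜ ℝ) :=
  ⁅compactSupportSubgroup Γ, compactSupportSubgroup Γ⁆

theorem compactSupportSubgroup_le (Γ : Subgroup (ℝ ≃ₜ ℝ)) : compactSupportSubgroup Γ ≤ Γ :=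
  fun _ ⟨_, _, h⟩ => h.1

theorem compactDerived_le_compactSupportSubgroup (Γ : Subgroup (ℝ ≃ₜ ℝ)) :
    compactDerived Γ ≤ compactSupportSubgroup Γ :=
  Subgroup.commutator_le_self _

theorem compactDerived_le (Γ : Subgroup (ℝ ≃ₜ ℝ)) : compactDerived Γ ≤ Γ :=
  (compactDerived_le_compactSupportSubgroup Γ).trans (compactSupportSubgroup_le Γ)

/-- Normality in `Γ` allows a perturbing factor on the left of a generator to be rewritten as one on
the right. -/
theorem conj_mem_compactDerived {Γ : Subgroup (ℝ ≃ₜ ℝ)} (hΓ : Γ ≤ HomeoPlus) {s c : ℝ ≃ₜ ℝ}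
    (hs : s ∈ Γ) (hc : c ∈ compactDerived Γ) : s * c * s⁻¹ ∈ compactDerived Γ := by
  have hle : (compactSupportSubgroup Γ).map (MulAut.conj s).toMonoidHom ≤ compactSupportSubgroup Γ := by
    rintro _ ⟨g, ⟨a, b, hg⟩, rfl⟩
    refine ⟨s a, s b, ?_⟩
    rw [← preimage_symm_Icc (hΓ hs)]
    exact conj_mem_supportedSubgroup hs hg
  have h : (MulAut.conj s).toMonoidHom c ∈
      (compactDerived Γ).map (MulAut.conj s).toMonoidHom := ⟨c, hc, rfl⟩
  rw [compactDerived, Subgroup.map_commutator] at h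
  exact Subgroup.commutator_mono hle hle h

/-- The element is a commutator of conjugates of a right-sided and a left-sided element whose
half-line supports overlap only in a small interval around `x`. -/
theorem exists_compactSupport_ne {Γ : Subgroup (ℝ ≃ₜ ℝ)} (hΓ : Γ ≤ HomeoPlus)
    (hmin : MinimalAction Γ) (hos : HasOneSidedElements Γ) (x : ℝ) {U : Set ℝ} (hU : U ∈ 𝓝 x) :
    ∃ c ∈ compactSupportSubgroup Γ, (∀ y ∉ U, c y = y) ∧ c x ≠ x := by
  obtain ⟨l, w, hlw, hsub⟩ := mem_nhds_iff_exists_Ioo_subset.1 hU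
  obtain ⟨f, hf, r, p, hrp, hfr, hfp, hflt⟩ := exists_right_sided hΓ hos
  obtain ⟨g, hg, q, r', hqr, hgr, hglt⟩ := exists_left_sided hΓ hos
  obtain ⟨s, hs, hsl, hsr⟩ := exists_contraction hΓ hmin hos r p hlw.1
  obtain ⟨s', hs', hsl', hsr'⟩ := exists_contraction hΓ hmin hos q r' hlw.2
  have hF : s * f * s⁻¹ ∈ Γ := Γ.mul_mem (Γ.mul_mem hs hf) (Γ.inv_mem hs)
  have hG : s' * g * s'⁻¹ ∈ Γ := Γ.mul_mem (Γ.mul_mem hs' hg) (Γ.inv_mem hs')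
  have hFr : ∀ y < s r, (s * f * s⁻¹) y = y := fun y hy => by
    have : s.symm y < r := (hΓ hs).lt_iff_lt.1 (by simpa using hy)
    rw [mul_apply, mul_apply, inv_apply, hfr _ this, apply_symm_apply]
  have hFlt : ∀ y, s p < y → (s * f * s⁻¹) y < y := fun y hy => by
    have : p < s.symm y := (hΓ hs).lt_iff_lt.1 (by simpa using hy)
    have := hΓ hs (hflt _ this)
    simpa using this
  have hGr : ∀ y, s' r' < y → (s' * g * s'⁻¹) y = y := fun y hy => by
    have : r' < s'.symm y := (hΓ hs').lt_iff_lt.1 (by simpa using hy)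
    rw [mul_apply, mul_apply, inv_apply, hgr _ this, apply_symm_apply]
  have hGlt : ∀ y < s' q, (s' * g * s'⁻¹) y < y := fun y hy => by
    have : s'.symm y < q := (hΓ hs').lt_iff_lt.1 (by simpa using hy)
    have := hΓ hs' (hglt _ this)
    simpa using this
  generalize s * f * s⁻¹ = F at hF hFr hFlt
  generalize s' * g * s'⁻¹ = G at hG hGr hGlt
  -- The power takes `x` out of the support of `F`. In `F * K⁻¹ * F⁻¹ * K` the factor `F⁻¹` is then
  -- invisible at `x`, and what remains is `F x`.
  obtain ⟨n, hn⟩ := exists_pow_apply_lt (u := G) (d := s r) (x := x)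
    fun y hy => hGlt y (hy.2.trans_lt hsl')
  have hGn := Γ.pow_mem hG n
  have hGnr : ∀ y, s' r' < y → (G ^ n) y = y := fun y hy => pow_apply_eq_self (hGr y hy) n
  have hsr₂ : s r ≤ s p := (hΓ hs).monotone hrp
  have hGnlt : ∀ y < s r, (G ^ n) y < s r := fun y hy =>
    (hΓ hGn (hy.trans_le (hsr₂.trans hsr.le))).trans hn
  generalize G ^ n = K at hGn hGnr hGnlt hn
  have hcs : F * K⁻¹ * F⁻¹ * K ∈ supportedSubgroup Γ (Set.Icc (s r) (s' r')) := by
    refine ⟨Γ.mul_mem (Γ.mul_mem (Γ.mul_mem hF (Γ.inv_mem hGn)) (Γ.inv_mem hF)) hGn,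
      fun y hy => ?_⟩
    simp only [mul_apply, inv_apply]
    rcases lt_or_ge y (s r) with h | h
    · rw [symm_apply_eq_self (hFr _ (hGnlt y h)), symm_apply_apply, hFr y h]
    · have h' : s' r' < y := not_le.1 fun h' => hy ⟨h, h'⟩
      have hxy : s p < y := hsr.trans (hsl'.trans_le (((hΓ hs').monotone hqr).trans h'.le))
      have h3 : y < F.symm y := lt_symm_self_of_lt (hΓ hF) (hFlt y hxy)
      rw [hGnr y h', symm_apply_eq_self (hGnr _ (h'.trans h3)), apply_symm_apply]
  refine ⟨_, ⟨s r, s' r', hcs⟩, fun y hy => hcs.2 y fun hy' => hy (hsub ?_), ?_⟩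
  · exact ⟨hsl.trans_le hy'.1, hy'.2.trans_lt hsr'⟩
  · simp only [mul_apply, inv_apply]
    rw [symm_apply_eq_self (hFr _ hn), symm_apply_apply]
    exact (hFlt x hsr).ne

/-- Choose `c₂` supported so near `x` that `c₁⁻¹` carries that neighbourhood off itself; the
commutator of `c₁` and `c₂` then acts on `x` as `c₂⁻¹`. -/
theorem exists_compactDerived_ne {Γ : Subgroup (ℝ ≃ₜ ℝ)} (hΓ : Γ ≤ HomeoPlus)
    (hmin : MinimalAction Γ) (hos : HasOneSidedElements Γ) (x : ℝ) {U : Set ℝ} (hU : U ∈ 𝓝 x) :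
    ∃ c ∈ compactDerived Γ, (∀ y ∉ U, c y = y) ∧ c x ≠ x := by
  obtain ⟨c₁, hc₁, hs₁, hne₁⟩ := exists_compactSupport_ne hΓ hmin hos x hU
  have hne : c₁.symm x ≠ x := fun h => hne₁ (c₁.symm_apply_eq.1 h).symm
  obtain ⟨V, W, hV, hW, hVW⟩ := t2_separation_nhds hne
  have hW' : W ∩ c₁.symm ⁻¹' V ∩ U ∈ 𝓝 x :=
    inter_mem (inter_mem hW (c₁.symm.continuous.continuousAt hV)) hU
  obtain ⟨c₂, hc₂, hs₂, hne₂⟩ := exists_compactSupport_ne hΓ hmin hos x hW'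
  refine ⟨c₁ * c₂ * c₁⁻¹ * c₂⁻¹, Subgroup.commutator_mem_commutator hc₁ hc₂, fun y hy => ?_, ?_⟩
  · have h1 := hs₁ y hy
    have h2 := hs₂ y fun h => hy h.2
    simp only [mul_apply, inv_apply]
    rw [symm_apply_eq_self h2, symm_apply_eq_self h1, h2, h1]
  · have hz : c₂.symm x ∈ W ∩ c₁.symm ⁻¹' V ∩ U := by
      by_contra hz
      have h := hs₂ _ hz
      rw [apply_symm_apply] at h
      rw [← h] at hz
      exact hz (mem_of_mem_nhds hW')
    have h2 := hs₂ (c₁.symm (c₂.symm x)) fun h => hVW.le_bot ⟨hz.1.2, h.1.1⟩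
    simp only [mul_apply, inv_apply]
    rw [h2, apply_symm_apply, Ne, symm_apply_eq]
    exact hne₂.symm

/-! ### Small perturbations -/

/-- The filter of homeomorphisms supported in small neighbourhoods of `z`. -/
def smallSupportAt (z : ℝ) : Filter (ℝ ≃ₜ ℝ) :=
  (𝓝 z).lift' fun U => {c | ∀ x ∉ U, c x = x}

theorem eventually_smallSupportAt {z : ℝ} {P : (ℝ ≃ₜ ℝ) → Prop} :
    (∀ᶠ c in smallSupportAt z, P c) ↔
      ∃ U ∈ 𝓝 z, ∀ c : ℝ ≃ₜ ℝ, (∀ x ∉ U, c x = x) → P c := by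
  have hmono : Monotone fun U : Set ℝ => {c : ℝ ≃ₜ ℝ | ∀ x ∉ U, c x = x} :=
    fun U V hUV c hc x hx => hc x fun h => hx (hUV h)
  exact mem_lift'_sets hmono

theorem tendsto_inv_smallSupportAt (z : ℝ) :
    Tendsto (fun c : ℝ ≃ₜ ℝ => c⁻¹) (smallSupportAt z) (smallSupportAt z) := by
  intro s hs
  obtain ⟨U, hU, h⟩ := eventually_smallSupportAt.1 hs
  exact eventually_smallSupportAt.2
    ⟨U, hU, fun c hc => h _ fun x hx => symm_apply_eq_self (hc x hx)⟩

/-- For `x = z`, a bijection supported in `V` preserves `V`; for `x ≠ z`, points near `x` avoid the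
support. -/
theorem tendsto_apply_smallSupportAt (z x : ℝ) :
    Tendsto (fun p : (ℝ ≃ₜ ℝ) × ℝ => p.1 p.2) (smallSupportAt z ×ˢ 𝓝 x) (𝓝 x) := by
  intro V hV
  rw [mem_map]
  rcases eq_or_ne z x with rfl | hne
  · have h1 : ∀ᶠ c : ℝ ≃ₜ ℝ in smallSupportAt z, ∀ y ∈ V, c y ∈ V := by
      refine eventually_smallSupportAt.2 ⟨V, hV, fun c hc y hy => ?_⟩
      by_contra hcy
      rw [c.injective (hc _ hcy)] at hcy
      exact hcy hy
    filter_upwards [h1.prod_mk hV] with p hp using hp.1 _ hp.2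
  · obtain ⟨U, W, hU, hW, hUW⟩ := t2_separation_nhds hne
    have h1 : ∀ᶠ c : ℝ ≃ₜ ℝ in smallSupportAt z, ∀ y ∉ U, c y = y :=
      eventually_smallSupportAt.2 ⟨U, hU, fun c hc => hc⟩
    filter_upwards [h1.prod_mk (inter_mem hV hW)] with p hp
    rw [Set.mem_preimage, hp.1 _ fun h => hUW.le_bot ⟨h, hp.2.2⟩]
    exact hp.2.1

/-! ### Continuity and locality of words -/

section Words

variable {ι : Type*}

theorem lift_mem_of_forall_mem {H : Subgroup (ℝ ≃ₜ ℝ)} {t : ι → ℝ ≃ₜ ℝ} (ht : ∀ i, t i ∈ H)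
    (W : FreeGroup ι) : FreeGroup.lift t W ∈ H := by
  have h : (FreeGroup.lift t).range ≤ H := by
    rw [FreeGroup.range_lift_eq_closure, Subgroup.closure_le]
    rintro _ ⟨i, rfl⟩
    exact ht i
  exact h ⟨W, rfl⟩

/-- Convergence is joint in the perturbation and the point, so that it composes along products of
words and becomes uniform on compact intervals. -/
theorem tendsto_lift_update [DecidableEq ι] (t : ι → ℝ ≃ₜ ℝ) (i : ι) (z : ℝ) (W : FreeGroup ι) :
    ∀ x, Tendsto (fun p : (ℝ ≃ₜ ℝ) × ℝ =>
      FreeGroup.lift (Function.update t i (t i * p.1)) W p.2)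
      (smallSupportAt z ×ˢ 𝓝 x) (𝓝 (FreeGroup.lift t W x)) := by
  induction W using FreeGroup.induction_on with
  | C1 => exact fun x => by simpa using tendsto_snd
  | of j =>
    intro x
    simp only [FreeGroup.lift_apply_of]
    rcases eq_or_ne j i with rfl | hne
    · simp only [Function.update_self, mul_apply]
      exact ((t j).continuous.tendsto x).comp (tendsto_apply_smallSupportAt z x)
    · simp only [Function.update_of_ne hne]
      exact ((t j).continuous.tendsto x).comp tendsto_snd
  | inv_of j _ =>
    intro x
    simp only [map_inv, FreeGroup.lift_apply_of]
    rcases eq_or_ne j i with rfl | hne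
    · simp only [Function.update_self, mul_inv_rev, mul_apply]
      refine (tendsto_apply_smallSupportAt z ((t j)⁻¹ x)).comp
        (((tendsto_inv_smallSupportAt z).comp tendsto_fst).prodMk ?_)
      exact ((t j)⁻¹.continuous.tendsto x).comp tendsto_snd
    · simp only [Function.update_of_ne hne]
      exact ((t j)⁻¹.continuous.tendsto x).comp tendsto_snd
  | mul W₁ W₂ h₁ h₂ =>
    intro x
    simp only [map_mul, mul_apply]
    exact (h₁ (FreeGroup.lift t W₂ x)).comp (tendsto_fst.prodMk (h₂ x))

/-- By monotonicity, all intermediate points of trajectories starting in `[a, ∞)` stay in one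
half-line `[b, ∞)`. -/
theorem exists_forall_ge_lift_eq {t : ι → ℝ ≃ₜ ℝ} (ht : ∀ i, t i ∈ HomeoPlus) (W : FreeGroup ι) :
    ∀ a : ℝ, ∃ b : ℝ, ∀ t' : ι → ℝ ≃ₜ ℝ, (∀ i x, b ≤ x → t' i x = t i x) →
      ∀ x, a ≤ x → FreeGroup.lift t' W x = FreeGroup.lift t W x := by
  induction W using FreeGroup.induction_on with
  | C1 => exact fun a => ⟨a, fun t' _ x _ => by simp⟩
  | of j => exact fun a => ⟨a, fun t' h x hx => by simpa using h j x hx⟩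
  | inv_of j _ =>
    refine fun a => ⟨(t j).symm a, fun t' h x hx => ?_⟩
    have hx' : (t j).symm a ≤ (t j).symm x :=
      (HomeoPlus.inv_mem (ht j) : StrictMono (t j).symm).monotone hx
    simp only [map_inv, FreeGroup.lift_apply_of, inv_apply]
    rw [symm_apply_eq, h j _ hx', apply_symm_apply]
  | mul W₁ W₂ h₁ h₂ =>
    intro a
    obtain ⟨b₂, hb₂⟩ := h₂ a
    obtain ⟨b₁, hb₁⟩ := h₁ (FreeGroup.lift t W₂ a)
    refine ⟨min b₁ b₂, fun t' h x hx => ?_⟩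
    simp only [map_mul, mul_apply]
    rw [hb₂ t' (fun i y hy => h i y ((min_le_right _ _).trans hy)) x hx]
    exact hb₁ t' (fun i y hy => h i y ((min_le_left _ _).trans hy)) _
      ((lift_mem_of_forall_mem ht W₂ : StrictMono _).monotone hx)

theorem exists_forall_le_lift_eq {t : ι → ℝ ≃ₜ ℝ} (ht : ∀ i, t i ∈ HomeoPlus) (W : FreeGroup ι) :
    ∀ b : ℝ, ∃ a : ℝ, ∀ t' : ι → ℝ ≃ₜ ℝ, (∀ i x, x ≤ b → t' i x = t i x) →
      ∀ x, x ≤ a → FreeGroup.lift t' W x = FreeGroup.lift t W x := by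
  induction W using FreeGroup.induction_on with
  | C1 => exact fun b => ⟨b, fun t' _ x _ => by simp⟩
  | of j => exact fun b => ⟨b, fun t' h x hx => by simpa using h j x hx⟩
  | inv_of j _ =>
    refine fun b => ⟨t j b, fun t' h x hx => ?_⟩
    have hx' : (t j).symm x ≤ b := by
      rw [← (ht j : StrictMono (t j)).le_iff_le, apply_symm_apply]
      exact hx
    simp only [map_inv, FreeGroup.lift_apply_of, inv_apply]
    rw [symm_apply_eq, h j _ hx', apply_symm_apply]
  | mul W₁ W₂ h₁ h₂ =>
    intro b
    obtain ⟨a₁, ha₁⟩ := h₁ b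
    obtain ⟨a₂, ha₂⟩ := h₂ b
    refine ⟨min a₂ ((FreeGroup.lift t W₂).symm a₁), fun t' h x hx => ?_⟩
    simp only [map_mul, mul_apply]
    rw [ha₂ t' h x (hx.trans (min_le_left _ _))]
    refine ha₁ t' h _ ?_
    have h₃ := (lift_mem_of_forall_mem ht W₂ : StrictMono _).monotone (hx.trans (min_le_right _ _))
    simpa using h₃

end Words

/-- The tuple `t` is obtained from `γ` by multiplication with elements of `compactDerived Γ`
supported to the left of `B`, in such a way that each word `W` with `(W, q) ∈ Y` moves all points of
`(-∞, q)` to the left. -/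
structure IsPerturbation {ι : Type*} (Γ : Subgroup (ℝ ≃ₜ ℝ)) (γ : ι → ℝ ≃ₜ ℝ) (B : ℝ)
    (Y : Finset (FreeGroup ι × ℝ)) (t : ι → ℝ ≃ₜ ℝ) : Prop where
  mem : ∀ i, t i ∈ Γ
  inv_mul_mem : ∀ i, (γ i)⁻¹ * t i ∈ compactDerived Γ
  eq_of_le : ∀ i x, B ≤ x → t i x = γ i x
  lift_lt : ∀ w ∈ Y, ∀ x < w.2, FreeGroup.lift t w.1 x < x

/-- On `[a, ∞)` a word of `Y` is determined by `γ` on `[B, ∞)`; far to the left it acts as for `t`;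
on the compact interval between, the strict inequality survives by continuity. -/
theorem IsPerturbation.eventually_update {ι : Type*} [DecidableEq ι] {Γ : Subgroup (ℝ ≃ₜ ℝ)}
    (hΓ : Γ ≤ HomeoPlus) {γ : ι → ℝ ≃ₜ ℝ} {B : ℝ} {Y : Finset (FreeGroup ι × ℝ)}
    (hB : ∀ w ∈ Y, ∃ a < w.2, ∀ t' : ι → ℝ ≃ₜ ℝ, (∀ i x, B ≤ x → t' i x = γ i x) →
      ∀ x, a ≤ x → FreeGroup.lift t' w.1 x = FreeGroup.lift γ w.1 x)
    {t : ι → ℝ ≃ₜ ℝ} (ht : IsPerturbation Γ γ B Y t) {z : ℝ} (hz : z < B) (i : ι) :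
    ∀ᶠ c in smallSupportAt z, c ∈ compactDerived Γ →
      IsPerturbation Γ γ B Y (Function.update t i (t i * c)) := by
  have hright : ∀ᶠ c : ℝ ≃ₜ ℝ in smallSupportAt z, ∀ j x, B ≤ x →
      Function.update t i (t i * c) j x = γ j x := by
    refine eventually_smallSupportAt.2 ⟨Set.Iio B, Iio_mem_nhds hz, fun c hc j x hx => ?_⟩
    rcases eq_or_ne j i with rfl | hne
    · rw [Function.update_self, mul_apply, hc x (not_lt.2 hx), ht.eq_of_le j x hx]
    · rw [Function.update_of_ne hne, ht.eq_of_le j x hx]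
  have hleft : ∀ᶠ c : ℝ ≃ₜ ℝ in smallSupportAt z, ∀ j x, x ≤ z - 1 →
      Function.update t i (t i * c) j x = t j x := by
    refine eventually_smallSupportAt.2
      ⟨Set.Ioi (z - 1), Ioi_mem_nhds (sub_one_lt z), fun c hc j x hx => ?_⟩
    rcases eq_or_ne j i with rfl | hne
    · rw [Function.update_self, mul_apply, hc x (not_lt.2 hx)]
    · rw [Function.update_of_ne hne]
  have hword : ∀ w ∈ Y, ∀ᶠ c : ℝ ≃ₜ ℝ in smallSupportAt z, ∀ x < w.2,
      FreeGroup.lift (Function.update t i (t i * c)) w.1 x < x := by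
    intro w hw
    obtain ⟨a, ha, haw⟩ := hB w hw
    obtain ⟨b, hb⟩ := exists_forall_le_lift_eq (fun j => hΓ (ht.mem j)) w.1 (z - 1)
    have hcpt : ∀ᶠ p : (ℝ ≃ₜ ℝ) × ℝ in smallSupportAt z ×ˢ 𝓝ˢ (Set.Icc b a),
        FreeGroup.lift (Function.update t i (t i * p.1)) w.1 p.2 < p.2 :=
      isCompact_Icc.mem_prod_nhdsSet_of_forall fun x hx =>
        (tendsto_lift_update t i z w.1 x).eventually_lt tendsto_snd
          (ht.lift_lt w hw x (hx.2.trans_lt ha))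
    have hcpt' : ∀ᶠ c : ℝ ≃ₜ ℝ in smallSupportAt z, ∀ x ∈ Set.Icc b a,
        FreeGroup.lift (Function.update t i (t i * c)) w.1 x < x := by
      obtain ⟨P, hP, Q, hQ, h⟩ := eventually_prod_iff.1 hcpt
      filter_upwards [hP] with c hc x hx using h hc (hQ.self_of_nhdsSet x hx)
    filter_upwards [hright, hleft, hcpt'] with c h1 h2 h3 x hx
    rcases le_total a x with hax | hxa
    · rw [haw _ h1 x hax, ← haw t ht.eq_of_le x hax]
      exact ht.lift_lt w hw x hx
    · rcases le_total x b with hxb | hbx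
      · rw [hb _ h2 x hxb]
        exact ht.lift_lt w hw x hx
      · exact h3 x ⟨hbx, hxa⟩
  filter_upwards [hright, (eventually_all_finset Y).2 hword] with c h1 h2 hc
  refine ⟨fun j => ?_, fun j => ?_, h1, h2⟩
  · rcases eq_or_ne j i with rfl | hne
    · rw [Function.update_self]
      exact Γ.mul_mem (ht.mem j) (compactDerived_le Γ hc)
    · rw [Function.update_of_ne hne]
      exact ht.mem j
  · rcases eq_or_ne j i with rfl | hne
    · rw [Function.update_self, ← mul_assoc]
      exact Subgroup.mul_mem _ (ht.inv_mul_mem j) hc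
    · rw [Function.update_of_ne hne]
      exact ht.inv_mul_mem j

/-! ### Words without fixed points -/

section Trajectories

variable {ι : Type*}

/-- The homeomorphism given by a letter. -/
def letterEval (t : ι → ℝ ≃ₜ ℝ) (l : ι × Bool) : ℝ ≃ₜ ℝ :=
  cond l.2 (t l.1) (t l.1)⁻¹

theorem lift_mk_cons (t : ι → ℝ ≃ₜ ℝ) (l : ι × Bool) (v : List (ι × Bool)) (x : ℝ) :
    FreeGroup.lift t (FreeGroup.mk (l :: v)) x =
      letterEval t l (FreeGroup.lift t (FreeGroup.mk v) x) := by
  rw [FreeGroup.lift_mk, FreeGroup.lift_mk, List.map_cons, List.prod_cons, mul_apply, letterEval]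

/-- Words act from their right end, so the points visited correspond to suffixes, and a trajectory
persists if each of its single steps does. -/
theorem lift_mk_eq_of_suffix {t t' : ι → ℝ ≃ₜ ℝ} {w : List (ι × Bool)} {x : ℝ}
    (h : ∀ l v, l :: v <:+ w → letterEval t' l (FreeGroup.lift t (FreeGroup.mk v) x) =
      FreeGroup.lift t (FreeGroup.mk (l :: v)) x) (v : List (ι × Bool)) (hv : v <:+ w) :
    FreeGroup.lift t' (FreeGroup.mk v) x = FreeGroup.lift t (FreeGroup.mk v) x := by
  induction v with
  | nil => simp [FreeGroup.lift_mk]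
  | cons l v ih =>
    rw [lift_mk_cons, ih ((List.suffix_cons l v).trans hv), h l v hv]

theorem pow_apply_injective {c : ℝ ≃ₜ ℝ} (hc : StrictMono c) {y : ℝ} (hy : c y ≠ y) :
    Function.Injective fun m : ℕ => (c ^ m) y := by
  rcases lt_or_gt_of_ne hy with h | h
  · refine (strictAnti_nat_of_succ_lt fun m => ?_).injective
    rw [pow_succ, mul_apply]
    exact (HomeoPlus.pow_mem hc m : StrictMono _) h
  · refine (strictMono_nat_of_lt_succ fun m => ?_).injective
    rw [pow_succ, mul_apply]
    exact (HomeoPlus.pow_mem hc m : StrictMono _) h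

/-- The points visited on the way have pairwise distinct positions left of `b`. -/
def IsSimpleTrajectory (t : ι → ℝ ≃ₜ ℝ) (w : List (ι × Bool)) (x b : ℝ) : Prop :=
  (∀ v, v <:+ w → FreeGroup.lift t (FreeGroup.mk v) x < b) ∧
    ∀ v v', v <:+ w → v' <:+ w →
      FreeGroup.lift t (FreeGroup.mk v) x = FreeGroup.lift t (FreeGroup.mk v') x → v = v'

theorem IsSimpleTrajectory.cons {t t' : ι → ℝ ≃ₜ ℝ} {w : List (ι × Bool)} {x b b' : ℝ}
    (hbb' : b ≤ b') (hs : IsSimpleTrajectory t w x b) {l : ι × Bool}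
    (heq : ∀ v, v <:+ w →
      FreeGroup.lift t' (FreeGroup.mk v) x = FreeGroup.lift t (FreeGroup.mk v) x)
    (hlt : letterEval t' l (FreeGroup.lift t (FreeGroup.mk w) x) < b')
    (hne : ∀ v, v <:+ w → letterEval t' l (FreeGroup.lift t (FreeGroup.mk w) x) ≠
      FreeGroup.lift t (FreeGroup.mk v) x) :
    IsSimpleTrajectory t' (l :: w) x b' := by
  have hl : FreeGroup.lift t' (FreeGroup.mk (l :: w)) x =
      letterEval t' l (FreeGroup.lift t (FreeGroup.mk w) x) := by
    rw [lift_mk_cons, heq w List.suffix_rfl]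
  refine ⟨fun v hv => ?_, fun v v' hv hv' h => ?_⟩
  · rcases List.suffix_cons_iff.1 hv with rfl | hv
    · rwa [hl]
    · rw [heq v hv]
      exact (hs.1 v hv).trans_le hbb'
  · rcases List.suffix_cons_iff.1 hv with rfl | hv <;>
      rcases List.suffix_cons_iff.1 hv' with rfl | hv'
    · rfl
    · rw [hl, heq v' hv'] at h
      exact absurd h (hne v' hv')
    · rw [hl, heq v hv] at h
      exact absurd h.symm (hne v hv)
    · rw [heq v hv, heq v' hv'] at h
      exact hs.2 v v' hv hv' h

/-- Induction on the word: the trajectory of the tail is kept, and the generator of the new first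
letter is altered only near its current endpoint `y`. The condition `C` stands for any property
stable under small perturbations to the left of `B`. -/
theorem exists_isSimpleTrajectory [DecidableEq ι] {Γ : Subgroup (ℝ ≃ₜ ℝ)}
    (hΓ : Γ ≤ HomeoPlus)
    (hne : ∀ x, ∀ U ∈ 𝓝 x, ∃ c ∈ compactDerived Γ, (∀ y ∉ U, c y = y) ∧ c x ≠ x)
    {C : (ι → ℝ ≃ₜ ℝ) → Prop} {B : ℝ} (hmem : ∀ t, C t → ∀ i, t i ∈ Γ)
    (hC : ∀ t, C t → ∀ z < B, ∀ i, ∀ᶠ c in smallSupportAt z, c ∈ compactDerived Γ →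
      C (Function.update t i (t i * c)))
    (w : List (ι × Bool)) (hw : FreeGroup.IsReduced w) (t : ι → ℝ ≃ₜ ℝ) (ht : C t) :
    ∀ b ≤ B, ∃ t', C t' ∧ (∀ i x, b ≤ x → t' i x = t i x) ∧ ∃ x, IsSimpleTrajectory t' w x b := by
  induction w with
  | nil =>
    refine fun b _ => ⟨t, ht, fun _ _ _ => rfl, b - 1, fun v hv => ?_, fun v v' hv hv' _ => ?_⟩
    · rw [List.suffix_nil.1 hv]
      simp [FreeGroup.lift_mk]
    · rw [List.suffix_nil.1 hv, List.suffix_nil.1 hv']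
  | cons l w ih =>
    intro b hb
    obtain ⟨i, β⟩ := l
    -- If the tail stays left of `b₁`, one further step by the generator or its inverse stays left
    -- of `b`.
    obtain ⟨b₁, hb₁, hb₂, hb₃⟩ : ∃ b₁ ≤ b, t i b₁ ≤ b ∧ b₁ ≤ t i b := by
      refine ⟨min (min b ((t i).symm b)) (t i b), (min_le_left _ _).trans (min_le_left _ _), ?_,
        min_le_right _ _⟩
      have h := (hΓ (hmem t ht i)).monotone
        ((min_le_left (min b ((t i).symm b)) (t i b)).trans (min_le_right _ _))
      simpa using h
    obtain ⟨t', ht', hagree, x, hs⟩ := ih (hw.infix (List.suffix_cons _ w).isInfix) b₁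
      (hb₁.trans hb)
    set y := FreeGroup.lift t' (FreeGroup.mk w) x with hy
    have hyb : y < b₁ := hs.1 w List.suffix_rfl
    have hmono : StrictMono (t' i) := hΓ (hmem t' ht' i)
    have htb : t' i b = t i b := hagree i b hb₁
    have htb₁ : t' i b₁ = t i b₁ := hagree i b₁ le_rfl
    let P : Finset ℝ := (w.tails.map fun v => FreeGroup.lift t' (FreeGroup.mk v) x).toFinset
    have hP : ∀ v, v <:+ w → FreeGroup.lift t' (FreeGroup.mk v) x ∈ P := fun v hv => by
      rw [List.mem_toFinset, List.mem_map]
      exact ⟨v, (List.mem_tails v w).2 hv, rfl⟩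
    have hPy : ∀ v, v <:+ w → v ≠ w → FreeGroup.lift t' (FreeGroup.mk v) x ∈ P.erase y :=
      fun v hv hvw => Finset.mem_erase.2
        ⟨fun h => hvw (hs.2 v w hv List.suffix_rfl h), hP v hv⟩
    have hU₀ : ((P.erase y : Finset ℝ) : Set ℝ)ᶜ ∈ 𝓝 y :=
      (P.erase y).finite_toSet.isClosed.isOpen_compl.mem_nhds (by simp)
    have hsuf : ∀ {l' v}, l' :: v <:+ w → v ≠ w := fun {l' v} h hvw => by
      have := h.length_le
      rw [hvw] at this
      simp at this
    cases β with
    | true =>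
      obtain ⟨U, hU, hUC⟩ := eventually_smallSupportAt.1
        (hC t' ht' y (hyb.trans_le (hb₁.trans hb)) i)
      -- The support avoids every visited point except `y`.
      obtain ⟨c₀, hc₀, hsupp, hc₀y⟩ := hne y _
        (inter_mem (inter_mem hU hU₀) (Iio_mem_nhds hyb))
      have hinj : Function.Injective fun m : ℕ => t' i ((c₀ ^ m) y) :=
        (t' i).injective.comp (pow_apply_injective (hΓ (compactDerived_le Γ hc₀)) hc₀y)
      -- The powers of `c₀` give infinitely many candidates for the next point, so one of them has
      -- not been visited.
      obtain ⟨_, ⟨m, rfl⟩, hm⟩ := (Set.infinite_range_of_injective hinj).exists_notMem_finset P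
      beta_reduce at hm
      have hcm := Subgroup.pow_mem _ hc₀ m
      have hsuppm : ∀ z ∉ U ∩ (↑(P.erase y))ᶜ ∩ Set.Iio b₁, (c₀ ^ m) z = z :=
        fun z hz => pow_apply_eq_self (hsupp z hz) m
      generalize c₀ ^ m = c at hm hcm hsuppm
      have hfix : ∀ v, v <:+ w → v ≠ w → c (FreeGroup.lift t' (FreeGroup.mk v) x) =
          FreeGroup.lift t' (FreeGroup.mk v) x :=
        fun v hv hvw => hsuppm _ fun h => h.1.2 (hPy v hv hvw)
      have hcb : ∀ z, b₁ ≤ z → c z = z := fun z hz => hsuppm z fun h => (not_lt.2 hz) h.2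
      refine ⟨_, hUC c (fun z hz => hsuppm z fun h => hz h.1.1) hcm, fun j z hz => ?_, x,
        hs.cons hb₁ (lift_mk_eq_of_suffix ?_) ?_ ?_⟩
      · rcases eq_or_ne j i with rfl | hji
        · rw [Function.update_self, mul_apply, hcb z (hb₁.trans hz), hagree j z (hb₁.trans hz)]
        · rw [Function.update_of_ne hji, hagree j z (hb₁.trans hz)]
      · rintro ⟨j, β⟩ v hv
        rw [lift_mk_cons]
        rcases eq_or_ne j i with rfl | hji
        · cases β with
          | true =>
            simp only [letterEval, cond_true, Function.update_self, mul_apply]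
            rw [hfix v ((List.suffix_cons _ v).trans hv) (hsuf hv)]
          | false =>
            -- Only a last step into `y` by the inverse of the same generator would be disturbed,
            -- and reducedness excludes it.
            have hvw : (j, false) :: v ≠ w := by
              rintro rfl
              simpa using (FreeGroup.isReduced_cons_cons.1 hw).1
            have h := hfix _ hv hvw
            rw [lift_mk_cons] at h
            simp only [letterEval, cond_false, Function.update_self, mul_inv_rev, mul_apply,
              inv_apply] at h ⊢
            exact symm_apply_eq_self h
        · simp only [letterEval, Function.update_of_ne hji]
      · simp only [letterEval, cond_true, Function.update_self, mul_apply]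
        refine (hmono ?_).trans_le (htb₁.trans_le hb₂)
        rw [← hcb b₁ le_rfl]
        exact hΓ (compactDerived_le Γ hcm) hyb
      · intro v hv h
        simp only [letterEval, cond_true, Function.update_self, mul_apply] at h
        exact hm (h.symm ▸ hP v hv)
    | false =>
      have hzb : (t' i).symm y < b := by
        rw [← hmono.lt_iff_lt, apply_symm_apply, htb]
        exact hyb.trans_le hb₃
      obtain ⟨U, hU, hUC⟩ := eventually_smallSupportAt.1
        (hC t' ht' _ (hzb.trans_le hb) i)
      have hU₁ : (t' i).symm ⁻¹' (U ∩ Set.Iio b) ∈ 𝓝 y :=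
        (t' i).symm.continuous.continuousAt (inter_mem hU (Iio_mem_nhds hzb))
      obtain ⟨c₀, hc₀, hsupp, hc₀y⟩ := hne y _ (inter_mem hU₁ hU₀)
      have hinj : Function.Injective fun m : ℕ => (t' i).symm ((c₀ ^ m) y) :=
        (t' i).symm.injective.comp (pow_apply_injective (hΓ (compactDerived_le Γ hc₀)) hc₀y)
      obtain ⟨_, ⟨m, rfl⟩, hm⟩ := (Set.infinite_range_of_injective hinj).exists_notMem_finset P
      beta_reduce at hm
      have hcm := Subgroup.pow_mem _ hc₀ m
      have hsuppm : ∀ z ∉ (t' i).symm ⁻¹' (U ∩ Set.Iio b) ∩ (↑(P.erase y))ᶜ, (c₀ ^ m) z = z :=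
        fun z hz => pow_apply_eq_self (hsupp z hz) m
      generalize c₀ ^ m = c at hm hcm hsuppm
      have hfix : ∀ v, v <:+ w → v ≠ w → c (FreeGroup.lift t' (FreeGroup.mk v) x) =
          FreeGroup.lift t' (FreeGroup.mk v) x :=
        fun v hv hvw => hsuppm _ fun h => h.2 (hPy v hv hvw)
      -- For an inverse letter the alteration must precede `(t' i)⁻¹`: replacing `t' i` by `c⁻¹ * t'
      -- i` does this, and conjugation turns it into a right factor supported near `(t' i)⁻¹ y`.
      have hconj : (t' i)⁻¹ * c⁻¹ * t' i ∈ compactDerived Γ := by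
        have h := conj_mem_compactDerived hΓ (Γ.inv_mem (hmem t' ht' i)) (Subgroup.inv_mem _ hcm)
        rwa [inv_inv] at h
      have hsuppc : ∀ z ∉ U ∩ Set.Iio b, ((t' i)⁻¹ * c⁻¹ * t' i) z = z := fun z hz => by
        have h : c (t' i z) = t' i z := hsuppm _ fun h => hz (by simpa using h.1)
        rw [mul_apply, mul_apply, inv_apply, inv_apply, symm_apply_eq_self h, symm_apply_apply]
      have hmul : t' i * ((t' i)⁻¹ * c⁻¹ * t' i) = c⁻¹ * t' i := by group
      have hnew := hUC _ (fun z hz => hsuppc z fun h => hz h.1) hconj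
      rw [hmul] at hnew
      refine ⟨_, hnew, fun j z hz => ?_, x, hs.cons hb₁ (lift_mk_eq_of_suffix ?_) ?_ ?_⟩
      · rcases eq_or_ne j i with rfl | hji
        · rw [Function.update_self, ← hmul, mul_apply, hsuppc z fun h => (not_lt.2 hz) h.2,
            hagree j z (hb₁.trans hz)]
        · rw [Function.update_of_ne hji, hagree j z (hb₁.trans hz)]
      · rintro ⟨j, β⟩ v hv
        rw [lift_mk_cons]
        rcases eq_or_ne j i with rfl | hji
        · cases β with
          | true =>
            have hvw : (j, true) :: v ≠ w := by
              rintro rfl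
              simpa using (FreeGroup.isReduced_cons_cons.1 hw).1
            have h := hfix _ hv hvw
            rw [lift_mk_cons] at h
            simp only [letterEval, cond_true, Function.update_self, mul_apply, inv_apply] at h ⊢
            exact symm_apply_eq_self h
          | false =>
            simp only [letterEval, cond_false, Function.update_self, mul_inv_rev, mul_apply,
              inv_inv]
            rw [hfix v ((List.suffix_cons _ v).trans hv) (hsuf hv)]
        · simp only [letterEval, Function.update_of_ne hji]
      · simp only [letterEval, cond_false, Function.update_self, mul_inv_rev, mul_apply, inv_inv,
          inv_apply]
        rw [← hmono.lt_iff_lt, apply_symm_apply]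
        have h := hΓ (compactDerived_le Γ hcm)
          (show y < t' i b from hyb.trans_le (hb₃.trans_eq htb.symm))
        rwa [hsuppm (t' i b) fun h' => by simpa using h'.1.2] at h
      · intro v hv h
        simp only [letterEval, cond_false, Function.update_self, mul_inv_rev, mul_apply, inv_inv,
          inv_apply] at h
        exact hm (h.symm ▸ hP v hv)

theorem exists_forall_lift_ne_one [DecidableEq ι] {Γ : Subgroup (ℝ ≃ₜ ℝ)}
    (hΓ : Γ ≤ HomeoPlus)
    (hne : ∀ x, ∀ U ∈ 𝓝 x, ∃ c ∈ compactDerived Γ, (∀ y ∉ U, c y = y) ∧ c x ≠ x)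
    {C : (ι → ℝ ≃ₜ ℝ) → Prop} {B : ℝ} (hmem : ∀ t, C t → ∀ i, t i ∈ Γ)
    (hC : ∀ t, C t → ∀ z < B, ∀ i, ∀ᶠ c in smallSupportAt z, c ∈ compactDerived Γ →
      C (Function.update t i (t i * c)))
    {t₀ : ι → ℝ ≃ₜ ℝ} (ht₀ : C t₀) (S : Finset (FreeGroup ι)) (hS : 1 ∉ S) :
    ∃ t, C t ∧ ∀ w ∈ S, FreeGroup.lift t w ≠ 1 := by
  -- The induction needs nontriviality to survive every change left of `b`, since the next word is
  -- treated there.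
  suffices h : ∃ t, C t ∧ ∃ b ≤ B, ∀ t' : ι → ℝ ≃ₜ ℝ, (∀ i x, b ≤ x → t' i x = t i x) →
      ∀ w ∈ S, FreeGroup.lift t' w ≠ 1 by
    obtain ⟨t, ht, b, -, h⟩ := h
    exact ⟨t, ht, h t fun _ _ _ => rfl⟩
  induction S using Finset.induction_on with
  | empty => exact ⟨t₀, ht₀, B, le_rfl, by simp⟩
  | insert w S _ ih =>
    obtain ⟨t, ht, b, hb, h⟩ := ih fun h => hS (Finset.mem_insert_of_mem h)
    obtain ⟨t', ht', hagree, x, -, hinj⟩ := exists_isSimpleTrajectory hΓ hne hmem hC w.toWord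
      FreeGroup.isReduced_toWord t ht b hb
    obtain ⟨b', hb'⟩ := exists_forall_ge_lift_eq (fun i => hΓ (hmem t' ht' i)) w x
    refine ⟨t', ht', min b b', (min_le_left _ _).trans hb, fun t'' ht'' v hv => ?_⟩
    rcases Finset.mem_insert.1 hv with rfl | hv
    · intro hone
      have h1 := hb' t'' (fun i y hy => ht'' i y ((min_le_right _ _).trans hy)) x le_rfl
      have h2 := hinj v.toWord [] List.suffix_rfl (List.nil_suffix)
      rw [FreeGroup.mk_toWord, ← h1, hone] at h2
      have h3 := h2 (by simp [FreeGroup.lift_mk])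
      exact hS (Finset.mem_insert.2 (Or.inl (FreeGroup.toWord_eq_nil_iff.1 h3).symm))
    · exact h t'' (fun i y hy => (ht'' i y ((min_le_left _ _).trans hy)).trans (hagree i y hy)) v hv

end Trajectories

/-! ### Generation by perturbed tuples -/

theorem exists_forall_ge_lift_eq_finset {ι : Type*} {t : ι → ℝ ≃ₜ ℝ} (ht : ∀ i, t i ∈ HomeoPlus)
    (S : Finset (FreeGroup ι)) (a : ℝ) :
    ∃ b : ℝ, ∀ t' : ι → ℝ ≃ₜ ℝ, (∀ i x, b ≤ x → t' i x = t i x) →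
      ∀ W ∈ S, ∀ x, a ≤ x → FreeGroup.lift t' W x = FreeGroup.lift t W x := by
  classical
  induction S using Finset.induction_on with
  | empty => exact ⟨a, by simp⟩
  | insert W S _ ih =>
    obtain ⟨b, hb⟩ := ih
    obtain ⟨b', hb'⟩ := exists_forall_ge_lift_eq ht W a
    refine ⟨min b b', fun t' h V hV => ?_⟩
    rcases Finset.mem_insert.1 hV with rfl | hV
    · exact hb' t' fun i x hx => h i x ((min_le_right _ _).trans hx)
    · exact hb t' (fun i x hx => h i x ((min_le_left _ _).trans hx)) V hV

theorem exists_forall_le_lift_eq_finset {ι : Type*} {t : ι → ℝ ≃ₜ ℝ} (ht : ∀ i, t i ∈ HomeoPlus)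
    (S : Finset (FreeGroup ι)) (b : ℝ) :
    ∃ a : ℝ, ∀ t' : ι → ℝ ≃ₜ ℝ, (∀ i x, x ≤ b → t' i x = t i x) →
      ∀ W ∈ S, ∀ x, x ≤ a → FreeGroup.lift t' W x = FreeGroup.lift t W x := by
  classical
  induction S using Finset.induction_on with
  | empty => exact ⟨b, by simp⟩
  | insert W S _ ih =>
    obtain ⟨a, ha⟩ := ih
    obtain ⟨a', ha'⟩ := exists_forall_le_lift_eq ht W b
    refine ⟨min a a', fun t' h V hV x hx => ?_⟩
    rcases Finset.mem_insert.1 hV with rfl | hV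
    · exact ha' t' h x (hx.trans (min_le_right _ _))
    · exact ha t' h V hV x (hx.trans (min_le_left _ _))

theorem map_conj_supportedSubgroup {Γ : Subgroup (ℝ ≃ₜ ℝ)} (hΓ : Γ ≤ HomeoPlus) {s : ℝ ≃ₜ ℝ}
    (hs : s ∈ Γ) (a b : ℝ) :
    (supportedSubgroup Γ (Set.Icc a b)).map (MulAut.conj s).toMonoidHom =
      supportedSubgroup Γ (Set.Icc (s a) (s b)) := by
  apply le_antisymm
  · rintro _ ⟨g, hg, rfl⟩
    rw [← preimage_symm_Icc (hΓ hs)]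
    exact conj_mem_supportedSubgroup hs hg
  · intro g hg
    have h := conj_mem_supportedSubgroup (Γ.inv_mem hs) hg
    rw [preimage_symm_Icc (hΓ (Γ.inv_mem hs)), inv_apply, inv_apply, symm_apply_apply,
      symm_apply_apply] at h
    refine ⟨_, h, ?_⟩
    simp [MulAut.conj_apply, mul_assoc]

/-- Some interval subgroup is finitely generated for arbitrarily large intervals. -/
theorem HasFGIntervalSubgroup.exists_large {Γ : Subgroup (ℝ ≃ₜ ℝ)} (hΓ : Γ ≤ HomeoPlus)
    (hmin : MinimalAction Γ) (hos : HasOneSidedElements Γ) (hfg : HasFGIntervalSubgroup Γ)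
    (c d : ℝ) : ∃ a b, a < c ∧ d < b ∧ (supportedSubgroup Γ (Set.Icc a b)).FG := by
  obtain ⟨a₀, b₀, hab, hfg⟩ := hfg
  -- Contract `[c, d]` into the given interval; pulling that interval back by `s` makes it large.
  obtain ⟨s, hs, hsc, hsd⟩ := exists_contraction hΓ hmin hos c d hab
  refine ⟨s.symm a₀, s.symm b₀, ?_, ?_, ?_⟩
  · rw [← (hΓ hs).lt_iff_lt, apply_symm_apply]
    exact hsc
  · rw [← (hΓ hs).lt_iff_lt, apply_symm_apply]
    exact hsd
  · have h := map_conj_supportedSubgroup hΓ (Γ.inv_mem hs) a₀ b₀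
    rw [inv_apply, inv_apply] at h
    rw [← h]
    obtain ⟨S, hS⟩ := hfg
    classical
    exact ⟨S.image (MulAut.conj s⁻¹).toMonoidHom, by
      rw [Finset.coe_image, ← MonoidHom.map_closure, hS]⟩

/-- Here `x` and `y` are the errors in approximations of `u` and `v`; errors that commute with each
other and with the opposite element do not affect the commutator. -/
theorem commutator_mul_eq {G : Type*} [Group G] {u v x y : G} (hxv : Commute x v)
    (hyu : Commute y u) (hxy : Commute x y) :
    (u * x) * (v * y) * (u * x)⁻¹ * (v * y)⁻¹ = u * v * u⁻¹ * v⁻¹ := by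
  have h1 : x * (v * y) * x⁻¹ = v * y := (hxv.mul_right hxy).mul_inv_cancel
  have h2 : y * u⁻¹ * y⁻¹ = u⁻¹ := hyu.inv_right.mul_inv_cancel
  calc (u * x) * (v * y) * (u * x)⁻¹ * (v * y)⁻¹
      = u * (x * (v * y) * x⁻¹) * u⁻¹ * (v * y)⁻¹ := by group
    _ = u * v * (y * u⁻¹ * y⁻¹) * v⁻¹ := by rw [h1]; group
    _ = u * v * u⁻¹ * v⁻¹ := by rw [h2]

/-- A single conjugation by an element of `H` brings two given compactly supported elements into
`[a, b]` at once. -/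
theorem compactDerived_le_of_expanding {Γ H : Subgroup (ℝ ≃ₜ ℝ)} (hH : H ≤ Γ)
    (hΓ : Γ ≤ HomeoPlus) {a b : ℝ}
    (hcomm : ∀ u ∈ supportedSubgroup Γ (Set.Icc a b), ∀ v ∈ supportedSubgroup Γ (Set.Icc a b),
      u * v * u⁻¹ * v⁻¹ ∈ H)
    (hexp : ∀ c d, ∃ h ∈ H, h a ≤ c ∧ d ≤ h b) : compactDerived Γ ≤ H := by
  refine Subgroup.commutator_le.2 ?_
  rintro x ⟨c, d, hx⟩ y ⟨c', d', hy⟩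
  obtain ⟨h, hh, hha, hhb⟩ := hexp (min c c') (max d d')
  have hsub : ∀ {l m}, min c c' ≤ l → m ≤ max d d' → ∀ g ∈ supportedSubgroup Γ (Set.Icc l m),
      h⁻¹ * g * h ∈ supportedSubgroup Γ (Set.Icc a b) := fun {l m} hl hm g hg => by
    have hmono : StrictMono h.symm := hΓ (Γ.inv_mem (hH hh))
    have hg' := conj_mem_supportedSubgroup (Γ.inv_mem (hH hh)) hg
    rw [preimage_symm_Icc (hΓ (Γ.inv_mem (hH hh))), inv_inv] at hg'
    refine supportedSubgroup_mono Γ (Set.Icc_subset_Icc ?_ ?_) hg'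
    · simpa using hmono.monotone (hha.trans hl)
    · simpa using hmono.monotone (hm.trans hhb)
  have h1 := hcomm _ (hsub (min_le_left _ _) (le_max_left _ _) x hx) _
    (hsub (min_le_right _ _) (le_max_right _ _) y hy)
  have h2 := H.mul_mem (H.mul_mem hh h1) (H.inv_mem hh)
  have h3 : h * (h⁻¹ * x * h * (h⁻¹ * y * h) * (h⁻¹ * x * h)⁻¹ * (h⁻¹ * y * h)⁻¹) * h⁻¹ =
      x * y * x⁻¹ * y⁻¹ := by group
  rw [h3] at h2
  exact h2

/-- If `H` contains, up to errors in a compact part of `(-∞, ρ)`, each element supported in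
`[a, b]`, and an element that fixes `[a, ∞)` and moves `ρ` arbitrarily far to the left, then `H`
contains the commutators of the elements supported in `[a, b]`. -/
theorem commutator_mem_of_approx {Γ H : Subgroup (ℝ ≃ₜ ℝ)} (hH : H ≤ HomeoPlus) {a b ρ β : ℝ}
    (hρa : ρ < a) (hβρ : β ≤ ρ)
    (happrox : ∀ u ∈ supportedSubgroup Γ (Set.Icc a b), ∃ U ∈ H, (∀ x, ρ ≤ x → U x = u x) ∧
      ∀ x ≤ β, U x = x)
    {Z : ℝ ≃ₜ ℝ} (hZ : Z ∈ H) (hZβ : Z ρ < β) (hZa : ∀ x, a ≤ x → Z x = x)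
    {u v : ℝ ≃ₜ ℝ} (hu : u ∈ supportedSubgroup Γ (Set.Icc a b))
    (hv : v ∈ supportedSubgroup Γ (Set.Icc a b)) : u * v * u⁻¹ * v⁻¹ ∈ H := by
  obtain ⟨U, hUH, hUρ, hUβ⟩ := happrox u hu
  obtain ⟨V, hVH, hVρ, -⟩ := happrox v hv
  have hWv : ∀ x, Z ρ ≤ x → (v⁻¹ * (Z * V * Z⁻¹)) x = x := by
    intro x hx
    have hz : ρ ≤ Z.symm x := by
      rw [← (hH hZ : StrictMono Z).le_iff_le, apply_symm_apply]
      exact hx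
    simp only [mul_apply, inv_apply]
    rw [hVρ _ hz, symm_apply_eq]
    by_cases hzI : Z.symm x ∈ Set.Icc a b
    · have hzx : Z.symm x = x := by
        have h := hZa _ hzI.1
        rw [apply_symm_apply] at h
        exact h.symm
      have hvx : v x ∈ Set.Icc a b := by
        by_contra hvx
        have := v.injective (hv.2 _ hvx)
        rw [this, ← hzx] at hvx
        exact hvx hzI
      rw [hzx, hZa _ hvx.1]
    · have hxI : x ∉ Set.Icc a b := fun hxI => by
        rw [symm_apply_eq_self (hZa x hxI.1)] at hzI
        exact hzI hxI
      rw [hv.2 _ hzI, hv.2 _ hxI, apply_symm_apply]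
  have hUu : ∀ x, ρ ≤ x ∨ x ≤ β → (u⁻¹ * U) x = x := by
    rintro x (hx | hx)
    · rw [mul_apply, hUρ x hx, inv_apply, symm_apply_apply]
    · rw [mul_apply, hUβ x hx, inv_apply]
      exact symm_apply_eq_self (hu.2 x fun h => by linarith [h.1])
  have h := commutator_mul_eq (u := u) (v := v) (x := u⁻¹ * U) (y := v⁻¹ * (Z * V * Z⁻¹))
    (commute_of_forall fun x => by
      by_cases hx : x ∈ Set.Icc a b
      · exact Or.inl (hUu x (Or.inl (hρa.le.trans hx.1)))
      · exact Or.inr (hv.2 x hx))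
    (commute_of_forall fun x => by
      by_cases hx : x ∈ Set.Icc a b
      · exact Or.inl (hWv x (by linarith [hx.1]))
      · exact Or.inr (hu.2 x hx))
    -- The error of `U` lives in `[β, ρ]`, that of `Z * V * Z⁻¹` to the left of `Z ρ < β`.
    (commute_of_forall fun x => by
      rcases le_total (Z ρ) x with hx | hx
      · exact Or.inr (hWv x hx)
      · exact Or.inl (hUu x (Or.inr (hx.trans hZβ.le))))
  rw [mul_inv_cancel_left, mul_inv_cancel_left] at h
  rw [← h]
  have hW := H.mul_mem (H.mul_mem hZ hVH) (H.inv_mem hZ)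
  exact H.mul_mem (H.mul_mem (H.mul_mem hUH hW) (H.inv_mem hUH)) (H.inv_mem hW)

/-- Elements supported in `[a, b]` fix `ρ` and so preserve `[ρ, ∞)`; approximations with common `ρ`
and `β` can therefore be multiplied and inverted. -/
theorem exists_approx_of_closure {Γ H : Subgroup (ℝ ≃ₜ ℝ)} (hΓ : Γ ≤ HomeoPlus) {a b ρ β : ℝ}
    (hρa : ρ < a) {A : Set (ℝ ≃ₜ ℝ)}
    (hA : Subgroup.closure A = supportedSubgroup Γ (Set.Icc a b))
    (h : ∀ u ∈ A, ∃ U ∈ H, (∀ x, ρ ≤ x → U x = u x) ∧ ∀ x ≤ β, U x = x) {u : ℝ ≃ₜ ℝ}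
    (hu : u ∈ supportedSubgroup Γ (Set.Icc a b)) :
    ∃ U ∈ H, (∀ x, ρ ≤ x → U x = u x) ∧ ∀ x ≤ β, U x = x := by
  have hge : ∀ v ∈ supportedSubgroup Γ (Set.Icc a b), ∀ x, ρ ≤ x → ρ ≤ v x := fun v hv x hx => by
    rw [← hv.2 ρ fun h => (not_le.2 hρa) h.1]
    exact (hΓ hv.1).monotone hx
  rw [← hA] at hu
  induction hu using Subgroup.closure_induction with
  | mem u hu => exact h u hu
  | one => exact ⟨1, H.one_mem, fun _ _ => rfl, fun _ _ => rfl⟩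
  | mul u v hu hv ihu ihv =>
    obtain ⟨U, hU, hU₁, hU₂⟩ := ihu
    obtain ⟨V, hV, hV₁, hV₂⟩ := ihv
    refine ⟨U * V, H.mul_mem hU hV, fun x hx => ?_, fun x hx => ?_⟩
    · rw [mul_apply, mul_apply, hV₁ x hx, hU₁ _ (hge v (hA ▸ hv) x hx)]
    · rw [mul_apply, hV₂ x hx, hU₂ x hx]
  | inv u hu ih =>
    obtain ⟨U, hU, hU₁, hU₂⟩ := ih
    refine ⟨U⁻¹, H.inv_mem hU, fun x hx => ?_, fun x hx => symm_apply_eq_self (hU₂ x hx)⟩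
    rw [inv_apply, symm_apply_eq, hU₁ _ (hge _ (inv_mem (hA ▸ hu)) x hx), inv_apply,
      apply_symm_apply]

theorem exists_perturbation_generates {ι : Type*} [Finite ι] {Γ : Subgroup (ℝ ≃ₜ ℝ)}
    (hΓ : Γ ≤ HomeoPlus) (hmin : MinimalAction Γ) (hos : HasOneSidedElements Γ)
    (hfg : HasFGIntervalSubgroup Γ) {γ : ι → ℝ ≃ₜ ℝ}
    (hγ : Subgroup.closure (Set.range γ) = Γ) :
    ∃ (B : ℝ) (Y : Finset (FreeGroup ι × ℝ)), IsPerturbation Γ γ B Y γ ∧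
      (∀ w ∈ Y, ∃ a < w.2, ∀ t' : ι → ℝ ≃ₜ ℝ, (∀ i x, B ≤ x → t' i x = γ i x) →
        ∀ x, a ≤ x → FreeGroup.lift t' w.1 x = FreeGroup.lift γ w.1 x) ∧
      ∀ t, IsPerturbation Γ γ B Y t → Subgroup.closure (Set.range t) = Γ := by
  classical
  obtain ⟨f, hf, r, p, hrp, hfr, -, hflt⟩ := exists_right_sided hΓ hos
  obtain ⟨g, hg, q, r', hqr, hgr, hglt⟩ := exists_left_sided hΓ hos
  obtain ⟨a, b, ha, hb, A, hA⟩ := hfg.exists_large hΓ hmin hos (min r q) (max p r')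
  obtain ⟨har, haq⟩ := lt_min_iff.1 ha
  obtain ⟨hpb, hrb⟩ := max_lt_iff.1 hb
  -- This conjugate of `g` fixes `[a, ∞)`, so its powers can displace errors without affecting `[a,
  -- b]`.
  obtain ⟨s, hs, -, hsa⟩ := hmin.exists_mem_Ioo r' (sub_one_lt a)
  have hγΓ : ∀ i, γ i ∈ Γ := fun i => hγ ▸ Subgroup.subset_closure ⟨i, rfl⟩
  have hγp : ∀ i, γ i ∈ HomeoPlus := fun i => hΓ (hγΓ i)
  have hword : ∀ h ∈ Γ, ∃ W, FreeGroup.lift γ W = h := fun h hh => by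
    rwa [← hγ, ← FreeGroup.range_lift_eq_closure] at hh
  obtain ⟨F, hF⟩ := hword f hf
  obtain ⟨L, hL⟩ := hword g hg
  obtain ⟨L', hL'⟩ := hword (s * g * s⁻¹) (Γ.mul_mem (Γ.mul_mem hs hg) (Γ.inv_mem hs))
  have hAΓ : ∀ u ∈ A, u ∈ supportedSubgroup Γ (Set.Icc a b) := fun u hu =>
    hA ▸ Subgroup.subset_closure hu
  have hwordA : ∀ u, ∃ W, u ∈ A → FreeGroup.lift γ W = u := fun u => by
    by_cases hu : u ∈ A
    · obtain ⟨W, hW⟩ := hword u (hAΓ u hu).1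
      exact ⟨W, fun _ => hW⟩
    · exact ⟨1, fun h => absurd h hu⟩
  choose word hwordA using hwordA
  have hsq : s q < a := ((hΓ hs).monotone hqr).trans_lt hsa
  obtain ⟨ρ, hρ⟩ := exists_lt (s q)
  have hρa : ρ < a := hρ.trans hsq
  obtain ⟨B, hB⟩ := exists_forall_ge_lift_eq_finset hγp ({F, L, L'} ∪ A.image word) ρ
  have hgs : ∀ x, s r' < x → (s * g * s⁻¹) x = x := fun x hx => by
    have : r' < s.symm x := (hΓ hs).lt_iff_lt.1 (by simpa using hx)
    rw [mul_apply, mul_apply, inv_apply, hgr _ this, apply_symm_apply]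
  have hgslt : ∀ x < s q, (s * g * s⁻¹) x < x := fun x hx => by
    have : s.symm x < q := (hΓ hs).lt_iff_lt.1 (by simpa using hx)
    simpa using hΓ hs (hglt _ this)
  refine ⟨B, {(L, q), (L', s q)}, ⟨hγΓ, fun i => ?_, fun _ _ _ => rfl, ?_⟩, ?_, fun t ht => ?_⟩
  · rw [inv_mul_cancel]
    exact Subgroup.one_mem _
  · simp only [Finset.mem_insert, Finset.mem_singleton, forall_eq_or_imp, forall_eq, hL, hL']
    exact ⟨hglt, hgslt⟩
  · simp only [Finset.mem_insert, Finset.mem_singleton, forall_eq_or_imp, forall_eq]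
    exact ⟨⟨ρ, hρa.trans haq, fun t' ht' => hB t' ht' L (by simp)⟩,
      ⟨ρ, hρ, fun t' ht' => hB t' ht' L' (by simp)⟩⟩
  set H := Subgroup.closure (Set.range t) with hH
  have htH : ∀ i, t i ∈ H := fun i => Subgroup.subset_closure ⟨i, rfl⟩
  have hHΓ : H ≤ Γ := (Subgroup.closure_le _).2 (by rintro _ ⟨i, rfl⟩; exact ht.mem i)
  have hlift := lift_mem_of_forall_mem htH
  have hBt := hB t ht.eq_of_le
  -- The generators change only by compactly supported factors, so they are unchanged near `-∞`.
  obtain ⟨c, hc⟩ : ∃ c, ∀ x ≤ c, ∀ i, t i x = γ i x := by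
    refine eventually_atBot.1 (eventually_all.2 fun i => ?_)
    obtain ⟨l, m, hlm⟩ := compactDerived_le_compactSupportSubgroup Γ (ht.inv_mul_mem i)
    filter_upwards [eventually_lt_atBot l] with x hx
    have h := hlm.2 x fun h => (not_le.2 hx) h.1
    rwa [mul_apply, inv_apply, symm_apply_eq] at h
  obtain ⟨d, hd⟩ := exists_forall_le_lift_eq_finset hγp (A.image word) c
  have hexpand : compactDerived Γ ≤ H := by
    refine compactDerived_le_of_expanding hHΓ hΓ (a := a) (b := b) ?_ ?_
    · have hlt := ht.lift_lt (L', s q) (by simp)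
      -- As `ρ < s q`, the leftward push imposed by `Y` makes a power of this word carry `ρ` past
      -- the bound `min d ρ` of the errors.
      obtain ⟨n, hn⟩ := exists_pow_apply_lt (u := FreeGroup.lift t L') (d := min d ρ) (x := ρ)
        fun y hy => hlt y (hy.2.trans_lt hρ)
      intro u hu v hv
      refine commutator_mem_of_approx (hHΓ.trans hΓ) hρa (min_le_right d ρ)
        (fun u hu => exists_approx_of_closure hΓ hρa hA (fun u hu => ?_) hu)
        (H.pow_mem (hlift L') n) hn (fun x hx => pow_apply_eq_self ?_ n) hu hv
      · have hmem := Finset.mem_image_of_mem word hu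
        refine ⟨_, hlift (word u), fun x hx => ?_, fun x hx => ?_⟩
        · rw [hBt _ (Finset.mem_union_right _ hmem) x hx, hwordA u hu]
        · rw [hd t (fun i y hy => hc y hy i) _ hmem x (hx.trans (min_le_left _ _)), hwordA u hu]
          exact (hAΓ u hu).2 x fun h => by linarith [h.1, hx.trans (min_le_right _ _)]
      · rw [hBt L' (by simp) x (hρa.le.trans hx), hL']
        exact hgs x (hsa.trans_le hx)
    · intro l m
      have hFt : ∀ x, ρ ≤ x → FreeGroup.lift t F x = f x := fun x hx => by
        rw [hBt F (by simp) x hx, hF]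
      -- Inverse powers of `F` push `b` to the right while fixing `a`. Once the image of `b` exceeds
      -- `r'`, powers of `L` fix it and push `a` to the left.
      obtain ⟨n, hn⟩ := exists_pow_apply_lt (u := FreeGroup.lift t F) (d := b)
        (x := max m (r' + 1)) fun y hy => by
          rw [hFt y (by linarith [hy.1])]
          exact hflt y (hpb.trans_le hy.1)
      have hFa : (FreeGroup.lift t F ^ n).symm a = a :=
        symm_apply_eq_self (pow_apply_eq_self (by rw [hFt a hρa.le, hfr a har]) n)
      have hFn := H.pow_mem (hlift F) n
      have hFb : max m (r' + 1) < (FreeGroup.lift t F ^ n).symm b := by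
        rw [← (hΓ (hHΓ hFn)).lt_iff_lt, apply_symm_apply]
        exact hn
      generalize FreeGroup.lift t F ^ n = Φ at hFn hFa hFb
      obtain ⟨hFb₁, hFb₂⟩ := max_lt_iff.1 hFb
      obtain ⟨k, hk⟩ := exists_pow_apply_lt (u := FreeGroup.lift t L) (d := l) (x := a)
        fun y hy => ht.lift_lt (L, q) (by simp) y (hy.2.trans_lt haq)
      refine ⟨FreeGroup.lift t L ^ k * Φ⁻¹, H.mul_mem (H.pow_mem (hlift L) k) (H.inv_mem hFn),
        ?_, ?_⟩
      · rw [mul_apply, inv_apply, hFa]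
        exact hk.le
      · rw [mul_apply, inv_apply, pow_apply_eq_self]
        · exact hFb₁.le
        · rw [hBt L (by simp) _ (by linarith), hL]
          exact hgr _ (by linarith)
  refine le_antisymm hHΓ ?_
  rw [← hγ, Subgroup.closure_le]
  rintro _ ⟨i, rfl⟩
  have h := H.mul_mem (htH i) (H.inv_mem (hexpand (ht.inv_mul_mem i)))
  rwa [mul_inv_rev, inv_inv, mul_inv_cancel_left] at h

/-! ### Convergence to the free group -/

namespace MarkedGroup

variable {k : ℕ}

theorem eval_invRev_append (M : MarkedGroup.{u} k) (w w' : List (Fin k × Bool)) :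
    M.eval (FreeGroup.invRev w ++ w') = (M.eval w)⁻¹ * M.eval w' := by
  rw [← lift_mk, ← lift_mk, ← lift_mk, ← FreeGroup.mul_mk, ← FreeGroup.inv_mk, map_mul, map_inv]

theorem eval_append_gen (M : MarkedGroup.{u} k) (w : List (Fin k × Bool)) (i : Fin k) :
    M.eval (w ++ [(i, true)]) = M.eval w * M.gen i := by
  simp [eval_append_singleton]

/-- An edge between two vertices of the ball amounts to a relation of length at most `n + (n + 1)`.
-/
theorem ballIso_of_eval_eq_one_iff {M N : MarkedGroup.{u} k} {n : ℕ}
    (h : ∀ w : List (Fin k × Bool), w.length ≤ 2 * n + 1 → (M.eval w = 1 ↔ N.eval w = 1)) :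
    BallIso n M N := by
  have heq : ∀ w w' : List (Fin k × Bool), w.length ≤ n → w'.length ≤ n + 1 →
      (M.eval w = M.eval w' ↔ N.eval w = N.eval w') := fun w w' hw hw' => by
    have := h (FreeGroup.invRev w ++ w') (by
      rw [List.length_append, FreeGroup.invRev_length]; omega)
    rwa [eval_invRev_append, eval_invRev_append, inv_mul_eq_one, inv_mul_eq_one] at this
  choose word hlen hword using fun x : M.ball n => x.2
  let f : M.ball n → N.ball n := fun x => ⟨N.eval (word x), word x, hlen x, rfl⟩
  have hf : Function.Bijective f := by
    constructor
    · intro x y hxy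
      apply Subtype.ext
      rw [← hword x, ← hword y]
      exact (heq _ _ (hlen x) ((hlen y).trans n.le_succ)).2 (Subtype.mk.inj hxy)
    · rintro ⟨_, w, hw, rfl⟩
      refine ⟨⟨M.eval w, w, hw, rfl⟩, Subtype.ext ?_⟩
      exact (heq _ _ (hlen _) (hw.trans n.le_succ)).1 (hword _)
  refine ⟨Equiv.ofBijective f hf, fun x => ?_, fun x y i => ?_⟩
  · rw [← hword x]
    exact h _ (by have := hlen x; omega)
  · rw [← hword x, ← hword y, ← eval_append_gen]
    change _ ↔ N.eval (word y) = N.eval (word x) * N.gen i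
    rw [← eval_append_gen]
    exact heq _ _ (hlen y) (by simpa using hlen x)

end MarkedGroup

theorem lift_standardFreeMarking_injective (k : ℕ) :
    Function.Injective (FreeGroup.lift (standardFreeMarking.{u} k).gen) := by
  have h : FreeGroup.lift (standardFreeMarking.{u} k).gen = FreeGroup.map ULift.up := by
    ext i
    simp [standardFreeMarking]
  rw [h]
  exact FreeGroup.map_injective ULift.up_injective

theorem GroupMarking.dist_standardFreeMarking_le {G : Type u} [Group G] {k : ℕ}
    (S : GroupMarking k G) (n : ℕ)
    (hS : ∀ w : FreeGroup (Fin k), w ≠ 1 → w.norm ≤ 2 * n → FreeGroup.lift S.gen w ≠ 1) :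
    dist S.toSpace (standardFreeMarking.{u} k).toSpace ≤ Real.exp (-((n - 1 : ℕ) : ℝ)) := by
  change MarkedGroup.markedDist _ _ ≤ _
  -- Only radii `m < n` are needed, and then `2 * m + 1 ≤ 2 * n`.
  refine MarkedGroup.markedDist_le_exp fun m hm =>
    MarkedGroup.ballIso_of_eval_eq_one_iff fun w hw => ?_
  rw [← MarkedGroup.lift_mk, ← MarkedGroup.lift_mk]
  have h1 := map_eq_one_iff _ (lift_standardFreeMarking_injective.{u} k)
    (x := FreeGroup.mk w)
  refine Iff.trans ⟨fun h => ?_, fun h => ?_⟩ h1.symm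
  · by_contra hne
    exact hS _ hne (FreeGroup.norm_mk_le.trans (by omega)) h
  · rw [h, map_one]

theorem tendsto_standardFreeMarking {G : Type u} [Group G] {k : ℕ}
    (h : ∀ n : ℕ, ∃ t : Fin k → G, Subgroup.closure (Set.range t) = ⊤ ∧
      ∀ w : FreeGroup (Fin k), w ≠ 1 → w.norm ≤ n → FreeGroup.lift t w ≠ 1) :
    ∃ S : ℕ → GroupMarking k G,
      Tendsto (fun n => (S n).toSpace) atTop (𝓝 (standardFreeMarking.{u} k).toSpace) := by
  -- The extra `2` keeps the words comparing two generators nontrivial even for `n = 0`, which makes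
  -- each tuple injective.
  choose t ht hfree using fun n => h (2 * n + 2)
  have hinj : ∀ n, Function.Injective (t n) := fun n i j hij => by
    by_contra hne
    refine hfree n (FreeGroup.of i * (FreeGroup.of j)⁻¹) ?_ ?_ ?_
    · rw [Ne, mul_inv_eq_one]
      exact fun h => hne (FreeGroup.of_injective h)
    · refine (FreeGroup.norm_mul_le _ _).trans ?_
      rw [FreeGroup.norm_inv_eq, FreeGroup.norm_of, FreeGroup.norm_of]
      omega
    · simp [hij]
  refine ⟨fun n => ⟨t n, hinj n, ht n⟩, ?_⟩
  rw [tendsto_iff_dist_tendsto_zero]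
  refine squeeze_zero (fun _ => dist_nonneg) (fun n =>
    GroupMarking.dist_standardFreeMarking_le _ n fun w hw hwn => hfree n w hw (by omega)) ?_
  exact Real.tendsto_exp_neg_atTop_nhds_zero.comp
    (tendsto_natCast_atTop_atTop.comp (tendsto_sub_atTop_nat 1))

/-! ### Generating tuples without short relations -/

theorem finite_setOf_norm_le {ι : Type*} [DecidableEq ι] [Finite ι] (n : ℕ) :
    {w : FreeGroup ι | w.norm ≤ n}.Finite :=
  Set.Finite.of_finite_image ((List.finite_length_le (ι × Bool) n).subset
    (by rintro _ ⟨w, hw, rfl⟩; exact hw)) FreeGroup.toWord_injective.injOn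

theorem exists_generating_tuple_ne_one {ι : Type*} [DecidableEq ι] [Finite ι]
    {Γ : Subgroup (ℝ ≃ₜ ℝ)} (hΓ : Γ ≤ HomeoPlus) (hmin : MinimalAction Γ)
    (hos : HasOneSidedElements Γ) (hfg : HasFGIntervalSubgroup Γ) {γ : ι → ℝ ≃ₜ ℝ}
    (hγ : Subgroup.closure (Set.range γ) = Γ) (n : ℕ) :
    ∃ t : ι → ℝ ≃ₜ ℝ, Subgroup.closure (Set.range t) = Γ ∧
      ∀ w : FreeGroup ι, w ≠ 1 → w.norm ≤ n → FreeGroup.lift t w ≠ 1 := by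
  obtain ⟨B, Y, hpert, hB, hgen⟩ := exists_perturbation_generates hΓ hmin hos hfg hγ
  have hfin : {w : FreeGroup ι | w ≠ 1 ∧ w.norm ≤ n}.Finite :=
    (finite_setOf_norm_le n).subset fun w hw => hw.2
  obtain ⟨t, ht, hne⟩ := exists_forall_lift_ne_one hΓ
    (fun x U hU => exists_compactDerived_ne hΓ hmin hos x hU) (fun t ht => ht.mem)
    (fun t ht z hz i => ht.eventually_update hΓ hB hz i) hpert hfin.toFinset (by simp)
  exact ⟨t, hgen t ht, fun w hw hwn => hne w (by simpa using ⟨hw, hwn⟩)⟩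

theorem theorem1p1 {G : Type u} [Group G] [Group.FG G] (hG : InClassC G)
    (k : ℕ) (hk : Group.rank G = k) :
    ∃ S : ℕ → GroupMarking k G,
      Tendsto (fun n => (S n).toSpace) atTop (𝓝 (standardFreeMarking.{u} k).toSpace) := by
  obtain ⟨Γ, ⟨e⟩, hΓ, hmin, -, hos, hfg⟩ := hG
  obtain ⟨S, hcard, hS⟩ := Group.rank_spec G
  let ψ : G →* (ℝ ≃ₜ ℝ) := Γ.subtype.comp e.toMonoidHom
  have hψ : Function.Injective ψ := Γ.subtype_injective.comp e.injective
  have hψtop : (⊤ : Subgroup G).map ψ = Γ := by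
    rw [← MonoidHom.range_eq_map, MonoidHom.range_comp,
      MonoidHom.range_eq_top.2 e.surjective, ← MonoidHom.range_eq_map, Subgroup.range_subtype]
  let σ : Fin k ≃ S := (finCongr (hcard.trans hk).symm).trans S.equivFin.symm
  have hγ : Subgroup.closure (Set.range fun i => ψ (σ i)) = Γ := by
    have h : Set.range (fun i => ψ (σ i)) = ψ '' S := by
      rw [← Function.comp_def ψ, Set.range_comp, ← Function.comp_def Subtype.val,
        σ.surjective.range_comp, Subtype.range_coe_subtype]
      rfl
    rw [h, ← MonoidHom.map_closure, hS, hψtop]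
  refine tendsto_standardFreeMarking fun n => ?_
  obtain ⟨t, ht, hfree⟩ := exists_generating_tuple_ne_one hΓ hmin hos hfg hγ n
  have hmem : ∀ i, ∃ x, ψ x = t i := fun i => by
    have h : t i ∈ (⊤ : Subgroup G).map ψ := by
      rw [hψtop, ← ht]
      exact Subgroup.subset_closure ⟨i, rfl⟩
    obtain ⟨x, -, hx⟩ := h
    exact ⟨x, hx⟩
  choose t' ht' using hmem
  refine ⟨t', Subgroup.map_injective hψ ?_, fun w hw hwn hone => hfree w hw hwn ?_⟩
  · rw [MonoidHom.map_closure, hψtop, ← ht, ← Set.range_comp]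
    congr 2
    exact funext ht'
  · have h : FreeGroup.lift t = ψ.comp (FreeGroup.lift t') := by
      ext1 i
      simp [ht']
    rw [h, MonoidHom.comp_apply, hone, map_one]
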